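/- Notation. Let $q\ne 0$ be a complex number, fix a value of $\log q$, and put $q^\alpha=e^{\alpha\log q}$ for $\alpha\in\mathbb C$ (so $q^1=q$). For $A,p\in\mathbb C$ and an integer $k\ge 0$ let $(A;p)_k=\prod_{i=0}^{k-1}(1-Ap^i)$; for $|p|<1$ let $(A;p)_\infty=\prod_{i=0}^{\infty}(1-Ap^i)$; and for $u,\kappa\in\mathbb C$ with $|q^u|<1$ let $$(A;q^u)_\kappa=\frac{(A;q^u)_\infty}{(Aq^{u\kappa};q^u)_\infty},$$ where the reciprocal $1/(A;q^u)_\kappa$ is read as $(Aq^{u\kappa};q^u)_\infty/(A;q^u)_\infty$. For $\mathbf k=(k_1,\dots,k_n)\in\mathbb Z_{\ge0}^n$ let $|\mathbf k|=k_1+\cdots+k_n$ and $e_2(\mathbf k)=\sum_{1\le r<s\le n}k_rk_s$. Statement (an $A_m\to A_n$ transformation). Let $m,n\ge1$ be integers and let $h,t,a,b,c,d$ be complex numbers with $a\neq0$, $d\ne0$, $$|q^h|<1,\quad |q^t|<1,\quad |q^{ht}|<1,\quad |aq^{tm}|<1,\quad |dq^{h}|<1.$$ Suppose that $(cq^{h+1};q^h)_\infty\neq0$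 and $(-bq^{tmr+1};q^{tm})_\infty\ne0$ for $r=1,\dots,m$. Then both multiple series below converge absolutely, and $$\prod_{r=1}^m\frac{(aq^{tmr};q^{tm})_\infty}{(-bq^{tmr+1};q^{tm})_\infty}\cdot\frac{(cq^{h+1};q^h)_\infty}{(dq^h;q^h)_\infty} \sum_{j_1,\dots,j_m\ge0}\Bigg(\prod_{1\le r<s\le m}\frac{1-q^{t(r-s)+tm(j_r-j_s)}}{1-q^{t(r-s)}}\prod_{r=1}^m\frac{(-bq/a;q^{tm})_{j_r}}{(q^{tm};q^{tm})_{j_r}}$$ $$\qquad\times\frac{(dq^h;q^h)_{tmn|\mathbf j|}}{(cq^{h+1};q^h)_{tmn|\mathbf j|}}\,(aq^{tm})^{|\mathbf j|}\,q^{tm\sum_{r=1}^m(r-1)j_r}\Bigg)$$ $$=\sum_{k_1,\dots,k_n\ge0}\Bigg(\prod_{1\le r<s\le n}\frac{1-q^{h(r-s)+hn(k_r-k_s)}}{1-q^{h(r-s)}}\prod_{r=1}^n\frac{(cq^{1+h(r-n)}/d;q^h)_{nk_r}}{(q^{hr};q^h)_{nk_r}}$$ $$\qquad\times\prod_{r=1}^m\frac{(aq^{tmr};q^{tm})_{hn|\mathbf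 k|}}{(-bq^{1+tmr};q^{tm})_{hn|\mathbf k|}}\,(dq^{hn})^{|\mathbf k|}\,q^{h(n-1)\sum_{r=1}^n(r-1)k_r}\,q^{hn\,e_2(\mathbf k)}\Bigg).$$ -/

import Mathlib

open Finset

/-- `q ^ α` for a complex exponent `α`, where `L` is the chosen value of `log q`. -/
noncomputable def qPow (L α : ℂ) : ℂ := Complex.exp (α * L)

/-- The finite `q`-rising factorial `(A; p)_k = (1 - A) (1 - A p) ⋯ (1 - A p ^ (k - 1))`. -/
noncomputable def qFac (A p : ℂ) (k : ℕ) : ℂ := ∏ i ∈ range k, (1 - A * p ^ i)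

/-- The infinite `q`-rising factorial `(A; p)_∞ = ∏_{i ≥ 0} (1 - A p ^ i)`, for `|p| < 1`. -/
noncomputable def qFacInf (A p : ℂ) : ℂ := ∏' i : ℕ, (1 - A * p ^ i)

/-- The `q`-rising factorial of complex order `κ` in the base `q ^ u`:
`(A; q ^ u)_κ = (A; q ^ u)_∞ / (A q ^ (u κ); q ^ u)_∞`. -/
noncomputable def qFacC (L u A κ : ℂ) : ℂ :=
  qFacInf A (qPow L u) / qFacInf (A * qPow L (u * κ)) (qPow L u)

/-- The elementary symmetric function of degree two in `k_1, …, k_n`. -/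
def e2 {n : ℕ} (k : Fin n → ℕ) : ℕ := ∑ r : Fin n, ∑ s ∈ Ioi r, k r * k s

/-- The type `A` Vandermonde factor
`∏_{1 ≤ r < s ≤ n} (1 - q ^ (u (r - s) + u n (k_r - k_s))) / (1 - q ^ (u (r - s)))`. -/
noncomputable def vandermondeA (L u : ℂ) {n : ℕ} (k : Fin n → ℕ) : ℂ :=
  ∏ r : Fin n, ∏ s ∈ Ioi r,
    (1 - qPow L (u * ((r : ℂ) - (s : ℂ)) + u * n * ((k r : ℂ) - (k s : ℂ)))) /
      (1 - qPow L (u * ((r : ℂ) - (s : ℂ))))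

/-- The summand of the `m`-fold series. The `r`-th index, `1 ≤ r ≤ m`, is `r - 1 : Fin m`. -/
noncomputable def termJ (q L h t a b c d : ℂ) (n m : ℕ) (j : Fin m → ℕ) : ℂ :=
  vandermondeA L t j *
  (∏ r : Fin m, qFac (-b * q / a) (qPow L (t * m)) (j r) /
      qFac (qPow L (t * m)) (qPow L (t * m)) (j r)) *
  (qFacC L h (d * qPow L h) (t * m * n * ((∑ r, j r : ℕ) : ℂ)) /
      qFacC L h (c * qPow L (h + 1)) (t * m * n * ((∑ r, j r : ℕ) : ℂ))) *
  (a * qPow L (t * m)) ^ (∑ r, j r) *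
  qPow L (t * m * ((∑ r : Fin m, (r : ℕ) * j r : ℕ) : ℂ))

/-- The summand of the `n`-fold series. The `r`-th index, `1 ≤ r ≤ n`, is `r - 1 : Fin n`. -/
noncomputable def termK (L h t a b c d : ℂ) (n m : ℕ) (k : Fin n → ℕ) : ℂ :=
  vandermondeA L h k *
  (∏ r : Fin n,
    qFac (c * qPow L (1 + h * (((r : ℂ) + 1) - n)) / d) (qPow L h) (n * k r) /
      qFac (qPow L (h * ((r : ℂ) + 1))) (qPow L h) (n * k r)) *
  (∏ r : Fin m,
    qFacC L (t * m) (a * qPow L (t * m * ((r : ℂ) + 1))) (h * n * ((∑ i, k i : ℕ) : ℂ)) /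
      qFacC L (t * m) (-b * qPow L (1 + t * m * ((r : ℂ) + 1)))
        (h * n * ((∑ i, k i : ℕ) : ℂ))) *
  (d * qPow L (h * n)) ^ (∑ r, k r) *
  qPow L (h * ((n : ℂ) - 1) * ((∑ r : Fin n, (r : ℕ) * k r : ℕ) : ℂ)) *
  qPow L (h * n * (e2 k : ℂ))

/-! Both sides are iterated sums of one double series. Put X = q^(htmn) and F(j,k) = `coeffJ` j ·
`coeffK` k · X^(|j||k|). For fixed j the sum over k is a multiple q-binomial series in base q^h with
argument d q^h X^|j|. Its value is a quotient of two infinite products, which up to a constant is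
the quotient of factorials of complex order tmn|j| in the m-fold series (`termJ_eq`). For fixed k
the sum over j similarly gives the summand of the n-fold series (`termK_eq`). Since |X| ≤ 1, the
double series is dominated by the product of two absolutely convergent ones, so the order of
summation may be exchanged and both outer series converge.

The two inner sums rest on different multiple q-binomial theorems. In the j-series every index has a
single factorial. There the Vandermonde factor is a quotient of determinants whose r-th row involves
only j_r, so each entry is summed by the classical q-binomial theorem (`hasSum_vandermondeRatio`).

The k-series needs Milne's theorem (`sum_boxWeight`): the sum over |k| = K is the coefficient of u^K
in ∏ (c_r u;p)_∞/(y_r u;p)_∞. Both sides satisfy the same recursion in K, obtained from partial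
fractions and replacing one y_r by y_r/p. For p = P^n and y_r = P^(-r), 0 ≤ r < n, the n infinite
products interleave into a single one in base P, and the multiple series collapses to a classical
one. -/

/-! ### Partial fractions -/

section PartialFractions

variable {n : ℕ}

/-- Lagrange interpolation of the difference of two monic polynomials given by their roots. -/
theorem prod_sub_prod_eq_sum {y c : Fin n → ℂ} (hy : Function.Injective y) (x : ℂ) :
    ∏ s, (x - c s) - ∏ s, (x - y s) =
      ∑ r, (∏ s, (y r - c s)) * ∏ s ∈ univ.erase r, (x - y s) / (y r - y s) := by
  classical
  set f : Polynomial ℂ := Lagrange.nodal univ c - Lagrange.nodal univ y with hf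
  have hdeg : f.degree < #(univ : Finset (Fin n)) := by
    rw [← Lagrange.degree_nodal (s := univ) (v := c) (R := ℂ)]
    apply Polynomial.degree_sub_lt_left
    · rw [Lagrange.degree_nodal, Lagrange.degree_nodal]
    · exact Lagrange.nodal_ne_zero
    · rw [Lagrange.nodal_monic.leadingCoeff, Lagrange.nodal_monic.leadingCoeff]
  have h := congrArg (Polynomial.eval x) (Lagrange.eq_interpolate (v := y) hy.injOn hdeg)
  rw [Lagrange.interpolate_apply, Polynomial.eval_finsetSum] at h
  simp only [hf, Polynomial.eval_sub, Lagrange.eval_nodal, Polynomial.eval_mul,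
    Polynomial.eval_C] at h
  rw [h]
  refine sum_congr rfl fun r _ => ?_
  have h0 : ∏ s, (y r - y s) = 0 := prod_eq_zero (mem_univ r) (sub_self _)
  rw [h0, sub_zero, Lagrange.basis, Polynomial.eval_prod]
  congr 1
  refine prod_congr rfl fun s _ => ?_
  simp [Lagrange.basisDivisor, div_eq_mul_inv, mul_comm]

/-- The residue of `∏ (x - c_s) / (x - y_s)` at `x = y_r`. -/
noncomputable def residueAt (y c : Fin n → ℂ) (r : Fin n) : ℂ :=
  (∏ s, (y r - c s)) / ∏ s ∈ univ.erase r, (y r - y s)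

/-- Partial fraction expansion of ∏ (x - z_s)/(x - y_s), evaluated at x = 0. -/
theorem sum_residueAt_div {y z : Fin n → ℂ} (hy : Function.Injective y) (hy0 : ∀ r, y r ≠ 0) :
    ∑ r, residueAt y z r / y r = 1 - (∏ s, z s) / ∏ s, y s := by
  have h := prod_sub_prod_eq_sum (c := z) hy 0
  have hY : ∏ s, (-y s) ≠ 0 := prod_ne_zero_iff.mpr fun s _ => neg_ne_zero.mpr (hy0 s)
  have hY' : ∏ s, y s ≠ 0 := prod_ne_zero_iff.mpr fun s _ => hy0 s
  simp only [zero_sub] at h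
  have h2 : (∏ s, z s) / ∏ s, y s = (∏ s, (-z s)) / ∏ s, (-y s) := by
    rw [← prod_div_distrib, ← prod_div_distrib]
    exact prod_congr rfl fun s _ => (neg_div_neg_eq _ _).symm
  have h3 : ∑ r, residueAt y z r / y r = -((∏ s, (-z s) - ∏ s, (-y s)) / ∏ s, (-y s)) := by
    rw [h, sum_div, ← sum_neg_distrib]
    refine sum_congr rfl fun r _ => ?_
    rw [← mul_prod_erase univ (fun s => -y s) (mem_univ r), prod_div_distrib, residueAt]
    have hE : ∏ s ∈ univ.erase r, (-y s) ≠ 0 := prod_ne_zero_iff.mpr fun s _ =>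
      neg_ne_zero.mpr (hy0 s)
    have hD : ∏ s ∈ univ.erase r, (y r - y s) ≠ 0 := prod_ne_zero_iff.mpr fun s hs =>
      sub_ne_zero.mpr fun e => (ne_of_mem_erase hs) (hy e).symm
    have := hy0 r
    field_simp
  rw [h3, h2, sub_div, div_self hY]
  ring

/-- The interpolation formula at x = 1/u, multiplied by u^n: the form that matches the q-difference
equation in u. -/
theorem prod_one_sub_sub_prod_one_sub {y c : Fin n → ℂ} (hy : Function.Injective y) (u : ℂ) :
    ∏ s, (1 - c s * u) - ∏ s, (1 - y s * u) =
      u * ∑ r, residueAt y c r * ∏ s ∈ univ.erase r, (1 - y s * u) := by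
  by_cases hu : u = 0
  · simp [hu]
  have h := congrArg (fun x => u ^ n * x) (prod_sub_prod_eq_sum (c := c) hy u⁻¹)
  have key : ∀ v : Fin n → ℂ, u ^ n * ∏ s, (u⁻¹ - v s) = ∏ s, (1 - v s * u) := fun v => by
    have : u ^ n = ∏ _s : Fin n, u := by simp
    rw [this, ← prod_mul_distrib]
    exact prod_congr rfl fun s _ => by field_simp
  simp only [mul_sub, key, mul_sum] at h ⊢
  rw [h]
  refine sum_congr rfl fun r _ => ?_
  have : u ^ n = u * ∏ _s ∈ univ.erase r, u := by
    rw [mul_prod_erase univ (fun _ => u) (mem_univ r)]; simp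
  have h2 : ∏ s ∈ univ.erase r, (1 - y s * u) =
      (∏ _s ∈ univ.erase r, u) * ∏ s ∈ univ.erase r, (u⁻¹ - y s) := by
    rw [← prod_mul_distrib]
    exact prod_congr rfl fun s _ => by field_simp
  rw [this, h2, prod_div_distrib, residueAt]
  ring

end PartialFractions

/-! ### Power series of `q`-binomial type -/

section QBinomialSeries

open PowerSeries

/-- The formal power series `(c u; p)_∞ / (y u; p)_∞` in `u`. -/
noncomputable def qBinSeries (p y c : ℂ) : PowerSeries ℂ :=
  PowerSeries.mk fun k => (∏ i ∈ range k, (y - c * p ^ i)) / qFac p p k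

theorem qFac_zero (A p : ℂ) : qFac A p 0 = 1 := by simp [qFac]

theorem qFac_succ (A p : ℂ) (k : ℕ) : qFac A p (k + 1) = qFac A p k * (1 - A * p ^ k) := by
  simp [qFac, prod_range_succ]

theorem qFac_self_ne_zero {p : ℂ} (hp1 : ∀ i : ℕ, p ^ (i + 1) ≠ 1) (k : ℕ) : qFac p p k ≠ 0 :=
  prod_ne_zero_iff.mpr fun i _ => by
    rw [← pow_succ']; exact sub_ne_zero.mpr (hp1 i).symm

theorem coeff_one_sub_C_mul_X_mul_zero (a : ℂ) (F : PowerSeries ℂ) :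
    coeff 0 ((1 - C a * X) * F) = coeff 0 F := by
  simp

theorem coeff_one_sub_C_mul_X_mul_succ (a : ℂ) (F : PowerSeries ℂ) (k : ℕ) :
    coeff (k + 1) ((1 - C a * X) * F) = coeff (k + 1) F - a * coeff k F := by
  rw [sub_mul, one_mul, mul_assoc, map_sub, coeff_C_mul, coeff_succ_X_mul]

theorem rescale_one_sub_C_mul_X (p a : ℂ) :
    rescale p (1 - C a * X) = (1 - C (p * a) * X : PowerSeries ℂ) := by
  have h : rescale p (C a) = (C a : PowerSeries ℂ) := by
    ext k; rcases k with _ | k <;> simp [coeff_rescale, coeff_C]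
  rw [map_sub, map_one, map_mul, rescale_X, h]
  simp only [map_mul]
  ring

/-- Formal version of (A u;p)_∞ = (1 - A u)(A p u;p)_∞ for A = y and A = c. -/
theorem qBinSeries_mul {p : ℂ} (hp1 : ∀ i : ℕ, p ^ (i + 1) ≠ 1) (y c : ℂ) :
    (1 - C y * X) * qBinSeries p y c = (1 - C c * X) * rescale p (qBinSeries p y c) := by
  ext k
  cases k with
  | zero => simp [coeff_one_sub_C_mul_X_mul_zero, qBinSeries]
  | succ k =>
    rw [coeff_one_sub_C_mul_X_mul_succ, coeff_one_sub_C_mul_X_mul_succ, coeff_rescale,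
      coeff_rescale, qBinSeries, coeff_mk, coeff_mk, prod_range_succ, qFac_succ]
    have h1 := qFac_self_ne_zero hp1 k
    have h2 : 1 - p ^ (k + 1) ≠ 0 := sub_ne_zero.mpr (hp1 k).symm
    rw [← pow_succ']
    field_simp
    ring

theorem qBinSeries_div {p : ℂ} (hp : p ≠ 0) (hp1 : ∀ i : ℕ, p ^ (i + 1) ≠ 1) (y c : ℂ) :
    (1 - C (y / p) * X) * qBinSeries p (y / p) c = qBinSeries p y c := by
  have hP : ∀ k, ∏ i ∈ range k, (y / p - c * p ^ i) =
      (∏ i ∈ range k, (y - c * p ^ (i + 1))) / p ^ k := fun k => by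
    have : p ^ k = ∏ _i ∈ range k, p := by simp
    rw [this, ← prod_div_distrib]
    exact prod_congr rfl fun i _ => by field_simp; ring
  ext k
  cases k with
  | zero => simp [coeff_one_sub_C_mul_X_mul_zero, qBinSeries]
  | succ k =>
    rw [coeff_one_sub_C_mul_X_mul_succ, qBinSeries, qBinSeries, coeff_mk, coeff_mk, coeff_mk,
      hP, hP, prod_range_succ, prod_range_succ' (fun i => y - c * p ^ i), qFac_succ]
    have h1 := qFac_self_ne_zero hp1 k
    have h2 : 1 - p ^ (k + 1) ≠ 0 := sub_ne_zero.mpr (hp1 k).symm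
    rw [← pow_succ']
    field_simp
    ring

theorem constantCoeff_qBinSeries (p y c : ℂ) : constantCoeff (qBinSeries p y c) = 1 := by
  rw [← coeff_zero_eq_constantCoeff_apply]
  simp [qBinSeries, qFac]

/-- A `q`-difference equation of first order has at most one solution with constant term `1`. -/
theorem eq_of_mul_eq_mul_rescale {p : ℂ} (hp1 : ∀ i : ℕ, p ^ (i + 1) ≠ 1)
    {D N F G : PowerSeries ℂ} (hD : constantCoeff D = 1) (hN : constantCoeff N = 1)
    (hF : D * F = N * rescale p F) (hG : D * G = N * rescale p G)
    (hFG : constantCoeff F = constantCoeff G) : F = G := by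
  rw [← sub_eq_zero]
  have hH : D * (F - G) = N * rescale p (F - G) := by
    rw [map_sub, mul_sub, mul_sub, hF, hG]
  have h0 : constantCoeff (F - G) = 0 := by rw [map_sub, hFG, sub_self]
  generalize F - G = H at hH h0
  ext k
  rw [map_zero]
  induction k using Nat.strong_induction_on with
  | _ k ih =>
    cases k with
    | zero => simpa using h0
    | succ k =>
      have h := congrArg (coeff (k + 1)) hH
      -- All lower coefficients of `H` vanish by induction, so only the constant terms of `D` and
      -- `N` contribute and the equation becomes (p^(k+1) - 1) H_(k+1) = 0.
      rw [coeff_mul, coeff_mul, sum_eq_single (0, k + 1), sum_eq_single (0, k + 1)] at h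
      · simp only [coeff_zero_eq_constantCoeff, hD, hN, coeff_rescale, one_mul] at h
        have h2 : (p ^ (k + 1) - 1) * coeff (k + 1) H = 0 := by rw [sub_mul, ← h]; ring
        exact (mul_eq_zero.mp h2).resolve_left (sub_ne_zero.mpr (hp1 k))
      · rintro ⟨i, j⟩ hij hne
        rw [HasAntidiagonal.mem_antidiagonal] at hij
        have : j < k + 1 := by
          rcases Nat.eq_zero_or_pos i with rfl | hi
          · exact absurd (by simpa using hij) (fun e : j = k + 1 => hne (by rw [e]))
          · simp only at hij; omega
        simp [coeff_rescale, ih j this]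
      · simp
      · rintro ⟨i, j⟩ hij hne
        rw [HasAntidiagonal.mem_antidiagonal] at hij
        have : j < k + 1 := by
          rcases Nat.eq_zero_or_pos i with rfl | hi
          · exact absurd (by simpa using hij) (fun e : j = k + 1 => hne (by rw [e]))
          · simp only at hij; omega
        simp [ih j this]
      · simp

variable {n : ℕ}

/-- The product of the series `(c_r u; p)_∞ / (y_r u; p)_∞`. -/
noncomputable def qBinSeriesProd (p : ℂ) (y c : Fin n → ℂ) : PowerSeries ℂ :=
  ∏ r, qBinSeries p (y r) (c r)

theorem qBinSeriesProd_mul {p : ℂ} (hp1 : ∀ i : ℕ, p ^ (i + 1) ≠ 1) (y c : Fin n → ℂ) :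
    (∏ r, (1 - C (y r) * X)) * qBinSeriesProd p y c =
      (∏ r, (1 - C (c r) * X)) * rescale p (qBinSeriesProd p y c) := by
  rw [qBinSeriesProd, map_prod, ← prod_mul_distrib, ← prod_mul_distrib]
  exact prod_congr rfl fun r _ => qBinSeries_mul hp1 _ _

theorem qBinSeriesProd_update {p : ℂ} (hp : p ≠ 0) (hp1 : ∀ i : ℕ, p ^ (i + 1) ≠ 1)
    (y c : Fin n → ℂ) (r : Fin n) :
    (1 - C (y r / p) * X) * qBinSeriesProd p (Function.update y r (y r / p)) c =
      qBinSeriesProd p y c := by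
  rw [qBinSeriesProd, qBinSeriesProd, ← mul_prod_erase univ (fun s => qBinSeries p
      (Function.update y r (y r / p) s) (c s)) (mem_univ r),
    ← mul_prod_erase univ (fun r => qBinSeries p (y r) (c r)) (mem_univ r), ← mul_assoc,
    Function.update_self, qBinSeries_div hp hp1]
  congr 1
  refine prod_congr rfl fun s hs => ?_
  rw [Function.update_of_ne (ne_of_mem_erase hs)]

theorem prod_one_sub_C_mul_X_sub {y c : Fin n → ℂ} (hy : Function.Injective y) :
    ∏ s, (1 - C (c s) * X) - ∏ s, (1 - C (y s) * X) =
      (X : PowerSeries ℂ) * ∑ r, C (residueAt y c r) * ∏ s ∈ univ.erase r, (1 - C (y s) * X) := by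
  have h : ∏ s, (1 - Polynomial.C (c s) * Polynomial.X) -
      ∏ s, (1 - Polynomial.C (y s) * Polynomial.X) =
      (Polynomial.X : Polynomial ℂ) * ∑ r, Polynomial.C (residueAt y c r) *
        ∏ s ∈ univ.erase r, (1 - Polynomial.C (y s) * Polynomial.X) := by
    refine Polynomial.funext fun u => ?_
    simpa [Polynomial.eval_prod, Polynomial.eval_finsetSum] using
      prod_one_sub_sub_prod_one_sub (c := c) hy u
  have h2 := congrArg (Polynomial.coeToPowerSeries.ringHom (R := ℂ)) h
  simpa only [map_sub, map_prod, map_one, map_mul, map_sum,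
    Polynomial.coeToPowerSeries.ringHom_apply, Polynomial.coe_C, Polynomial.coe_X] using h2

/-- Let F be the product and F_r the product with y_r/p in place of y_r. The q-difference equation,
the partial fractions and F(pu) = (1 - y_r u) F_r(pu) give F(u) - F(pu) = u ∑ residue_r · F_r(pu);
coefficients are then compared. -/
theorem coeff_qBinSeriesProd_succ {p : ℂ} (hp : p ≠ 0) (hp1 : ∀ i : ℕ, p ^ (i + 1) ≠ 1)
    {y : Fin n → ℂ} (hy : Function.Injective y) (c : Fin n → ℂ) (K : ℕ) :
    (1 - p ^ (K + 1)) * coeff (K + 1) (qBinSeriesProd p y c) =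
      ∑ r, residueAt y c r * p ^ K *
        coeff K (qBinSeriesProd p (Function.update y r (y r / p)) c) := by
  have hne : (∏ s, (1 - C (y s) * X) : PowerSeries ℂ) ≠ 0 := by
    refine prod_ne_zero_iff.mpr fun s _ e => ?_
    have := congrArg constantCoeff e
    simp at this
  have key : qBinSeriesProd p y c - rescale p (qBinSeriesProd p y c) =
      X * ∑ r, C (residueAt y c r) *
        rescale p (qBinSeriesProd p (Function.update y r (y r / p)) c) := by
    apply mul_left_cancel₀ hne
    rw [mul_sub, qBinSeriesProd_mul hp1, ← sub_mul, prod_one_sub_C_mul_X_sub hy, mul_left_comm,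
      mul_assoc, sum_mul]
    congr 1
    rw [mul_sum]
    refine sum_congr rfl fun r _ => ?_
    rw [← qBinSeriesProd_update hp hp1 y c r, map_mul, rescale_one_sub_C_mul_X,
      mul_div_cancel₀ _ hp,
      ← mul_prod_erase univ (fun s => (1 - C (y s) * X : PowerSeries ℂ)) (mem_univ r)]
    ring
  have h := congrArg (coeff (K + 1)) key
  rw [map_sub, coeff_rescale, coeff_succ_X_mul, map_sum] at h
  rw [sub_mul, one_mul, h]
  refine sum_congr rfl fun r _ => ?_
  rw [coeff_C_mul, coeff_rescale]
  ring

end QBinomialSeries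

/-! ### The multiple `q`-binomial theorem for generic variables -/

section BoxWeight

variable {n : ℕ}

/-- The points `y_r p ^ i`, `i ∈ ℤ`, are all different from zero, and different for different
`r`. -/
def QGeneric (p : ℂ) (y : Fin n → ℂ) : Prop :=
  (∀ r, y r ≠ 0) ∧ ∀ r s, r ≠ s → ∀ i : ℤ, y r ≠ y s * p ^ i

theorem QGeneric.injective {p : ℂ} {y : Fin n → ℂ} (h : QGeneric p y) :
    Function.Injective y := fun r s e => by
  by_contra hne
  exact h.2 r s hne 0 (by simpa using e)

theorem QGeneric.update {p : ℂ} (hp : p ≠ 0) {y : Fin n → ℂ} (h : QGeneric p y) (r : Fin n) :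
    QGeneric p (Function.update y r (y r / p)) := by
  refine ⟨fun s => ?_, fun s s' hs i => ?_⟩
  · by_cases hr : s = r
    · subst hr; simpa using ⟨h.1 s, hp⟩
    · simpa [hr] using h.1 s
  · by_cases h1 : s = r
    · subst h1
      rw [Function.update_self, Function.update_of_ne (Ne.symm hs)]
      intro e
      refine h.2 s s' hs (i + 1) ?_
      rw [zpow_add_one₀ hp, ← mul_assoc, ← e, div_mul_cancel₀ _ hp]
    · rw [Function.update_of_ne h1]
      by_cases h2 : s' = r
      · subst h2
        rw [Function.update_self]
        intro e
        refine h.2 s s' hs (i - 1) ?_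
        rw [zpow_sub_one₀ hp, e]
        ring
      · rw [Function.update_of_ne h2]
        exact h.2 s s' hs i

/-- The summand of the multiple `q`-binomial series, as a product over the points
`y_r p ^ (-i)`, `0 ≤ i < k_r`. -/
noncomputable def boxWeight (p : ℂ) (y c : Fin n → ℂ) (k : Fin n → ℕ) : ℂ :=
  ∏ r, ∏ i ∈ range (k r), (-(y r / p ^ i) / p *
    ∏ s, (y r / p ^ i - c s) / (y r / p ^ i - y s / p ^ k s))

/-- The tuple `k` with its `r`-th entry increased by one. -/
abbrev incr (k : Fin n → ℕ) (r : Fin n) : Fin n → ℕ := k + Pi.single r 1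

/-- The end points y_s p^(-k_s) are the same for (y, k + e_r) and for (y with y_r/p, k). The two
products therefore differ only by the factor of the point y_r. -/
theorem boxWeight_add_single (p : ℂ) (y c : Fin n → ℂ) (k : Fin n → ℕ)
    (r : Fin n) :
    boxWeight p y c (incr k r) =
      (-y r / p * ∏ s, (y r - c s) / (y r - y s / p ^ (incr k r) s)) *
        boxWeight p (Function.update y r (y r / p)) c k := by
  have hz : ∀ s, Function.update y r (y r / p) s / p ^ k s =
      y s / p ^ (incr k r) s := fun s => by
    by_cases hs : s = r
    · subst hs; simp [pow_succ', div_div]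
    · simp [hs]
  simp only [boxWeight, hz]
  rw [← mul_prod_erase univ _ (mem_univ r),
    ← mul_prod_erase univ (fun t => ∏ i ∈ range (k t), _) (mem_univ r), ← mul_assoc]
  congr 1
  · have hk : (incr k r) r = k r + 1 := by simp
    generalize incr k r = k' at hk ⊢
    rw [hk, prod_range_succ', mul_comm]
    simp only [Function.update_self, pow_zero, div_one, pow_succ', div_div]
  · refine prod_congr rfl fun s hs => ?_
    have hs := ne_of_mem_erase hs
    have hk : (incr k r) s = k s := by simp [hs]
    rw [hk, Function.update_of_ne hs]

/-- The denominator ∏ (y_r - y_s p^(-k_s)) of the extra factor cancels the numerator of the residue,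
leaving the residue for c. -/
theorem boxWeight_add_single_mul_residueAt {p : ℂ} (hp : p ≠ 0)
    (hp1 : ∀ i : ℕ, p ^ (i + 1) ≠ 1) {y : Fin n → ℂ} (hy : QGeneric p y) (c : Fin n → ℂ)
    (k : Fin n → ℕ) (r : Fin n) :
    boxWeight p y c (incr k r) *
        (residueAt y (fun s => y s / p ^ (incr k r) s) r / y r) =
      -(residueAt y c r / p) * boxWeight p (Function.update y r (y r / p)) c k := by
  rw [boxWeight_add_single, prod_div_distrib, residueAt, residueAt]
  have h1 : ∏ s, (y r - y s / p ^ (incr k r) s) ≠ 0 := by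
    refine prod_ne_zero_iff.mpr fun s _ => sub_ne_zero.mpr ?_
    by_cases hs : r = s
    · subst hs
      intro e
      have hk : (incr k r) r = k r + 1 := by simp
      rw [hk, eq_div_iff (pow_ne_zero _ hp)] at e
      exact hp1 (k r) (mul_left_cancel₀ (hy.1 r) (by rw [e, mul_one]))
    · have := hy.2 r s hs (-((incr k r) s : ℕ))
      rwa [zpow_neg, zpow_natCast, ← div_eq_mul_inv] at this
  have h2 := hy.1 r
  have h3 : ∏ s ∈ univ.erase r, (y r - y s) ≠ 0 := prod_ne_zero_iff.mpr fun s hs =>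
    sub_ne_zero.mpr fun e => (ne_of_mem_erase hs) (hy.injective e).symm
  generalize ∏ s, (y r - y s / p ^ incr k r s) = Z at h1
  field_simp

/-- By `sum_residueAt_div` with z_s = y_s p^(-k_s), the weights residue_r / y_r add up to 1 -
p^(-|k|), which depends on k only through |k|. The r-th weight vanishes when k_r = 0, so its sum may
be reindexed by k ↦ k + e_r. This gives the recursion of `coeff_qBinSeriesProd_succ`. -/
theorem sum_boxWeight_succ {p : ℂ} (hp : p ≠ 0) (hp1 : ∀ i : ℕ, p ^ (i + 1) ≠ 1)
    {y : Fin n → ℂ} (hy : QGeneric p y) (c : Fin n → ℂ) (K : ℕ) :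
    (1 - p ^ (K + 1)) * ∑ k ∈ piAntidiag univ (K + 1), boxWeight p y c k =
      ∑ r, residueAt y c r * p ^ K *
        ∑ k ∈ piAntidiag univ K, boxWeight p (Function.update y r (y r / p)) c k := by
  have hpK : p ^ (K + 1) ≠ 0 := pow_ne_zero _ hp
  set φ : Fin n → (Fin n → ℕ) → ℂ := fun r k =>
    boxWeight p y c k * (residueAt y (fun s => y s / p ^ k s) r / y r) with hφ
  have h1 : ∀ k ∈ piAntidiag (univ : Finset (Fin n)) (K + 1),
      boxWeight p y c k * (1 - 1 / p ^ (K + 1)) = ∑ r, φ r k := fun k hk => by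
    rw [hφ, ← mul_sum, sum_residueAt_div hy.injective hy.1, prod_div_distrib, prod_pow_eq_pow_sum,
      (mem_piAntidiag.mp hk).1, div_div_cancel_left' (prod_ne_zero_iff.mpr fun s _ => hy.1 s),
      one_div]
  have h2 : ∀ r, ∑ k ∈ piAntidiag univ (K + 1), φ r k =
      ∑ k ∈ piAntidiag univ K, φ r (incr k r) := fun r => by
    symm
    refine sum_of_injOn (fun k => incr k r) (fun _ _ _ _ e => by simpa using e) ?_ ?_
      (fun _ _ => rfl)
    · intro k hk
      rw [mem_coe, mem_piAntidiag] at hk ⊢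
      refine ⟨?_, fun _ _ => mem_univ _⟩
      simp [sum_add_distrib, hk.1]
    · intro k hk hk'
      have hr : k r = 0 := by
        by_contra hr
        refine hk' ⟨k - Pi.single r 1, ?_, ?_⟩
        · have hle : Pi.single r 1 ≤ k := by
            intro s
            by_cases hs : s = r
            · subst hs; simpa using Nat.one_le_iff_ne_zero.mpr hr
            · simp [hs]
          have hs := (mem_piAntidiag.mp hk).1
          have : ∑ s, (k - Pi.single r 1 + Pi.single r 1 : Fin n → ℕ) s = K + 1 := by
            rw [tsub_add_cancel_of_le hle]; exact hs
          simp only [Pi.add_apply, sum_add_distrib, sum_pi_single', mem_univ, if_true] at this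
          simp only [mem_coe, mem_piAntidiag]
          exact ⟨by simpa using this, fun _ _ => mem_univ _⟩
        · ext s
          by_cases hs : s = r
          · subst hs; simp; omega
          · simp [hs]
      have : residueAt y (fun s => y s / p ^ k s) r = 0 := by
        rw [residueAt, prod_eq_zero (mem_univ r) (by simp [hr]), zero_div]
      simp [hφ, this]
  have h3 : (1 - 1 / p ^ (K + 1)) * ∑ k ∈ piAntidiag univ (K + 1), boxWeight p y c k =
      ∑ r, -(residueAt y c r / p) *
        ∑ k ∈ piAntidiag univ K, boxWeight p (Function.update y r (y r / p)) c k := by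
    rw [mul_comm, sum_mul, sum_congr rfl h1, sum_comm]
    refine sum_congr rfl fun r _ => ?_
    rw [h2, mul_sum]
    exact sum_congr rfl fun k _ => boxWeight_add_single_mul_residueAt hp hp1 hy c k r
  have h4 := congrArg (fun x => -(p ^ (K + 1)) * x) h3
  simp only [mul_sum (univ : Finset (Fin n)), ← mul_assoc] at h4
  have h5 : -(p ^ (K + 1)) * (1 - 1 / p ^ (K + 1)) = 1 - p ^ (K + 1) := by
    field_simp; ring
  rw [h5] at h4
  rw [h4]
  refine sum_congr rfl fun r _ => ?_
  congr 1
  field_simp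
  ring

/-- Milne's multiple `q`-binomial theorem, coefficient by coefficient. -/
theorem sum_boxWeight {p : ℂ} (hp : p ≠ 0) (hp1 : ∀ i : ℕ, p ^ (i + 1) ≠ 1) (c : Fin n → ℂ)
    (K : ℕ) {y : Fin n → ℂ} (hy : QGeneric p y) :
    ∑ k ∈ piAntidiag univ K, boxWeight p y c k =
      PowerSeries.coeff K (qBinSeriesProd p y c) := by
  -- The recursion changes y, and genericity is stable under the shift y_r ↦ y_r/p.
  induction K generalizing y with
  | zero => simp [boxWeight, qBinSeriesProd, constantCoeff_qBinSeries, map_prod]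
  | succ K ih =>
    apply mul_left_cancel₀ (sub_ne_zero.mpr (hp1 K).symm)
    rw [sum_boxWeight_succ hp hp1 hy, coeff_qBinSeriesProd_succ hp hp1 hy.injective]
    exact sum_congr rfl fun r _ => by rw [ih (hy.update hp r)]

end BoxWeight

/-! ### Rearrangement of the finite products -/

section Rearrangement

theorem qFac_succ' (A p : ℂ) (k : ℕ) : qFac A p (k + 1) = (1 - A) * qFac (p * A) p k := by
  simp only [qFac, prod_range_succ', pow_zero, mul_one]
  rw [mul_comm]
  congr 1
  exact prod_congr rfl fun i _ => by ring

theorem qFac_mul_one_sub (A p : ℂ) (k : ℕ) :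
    qFac A p k * (1 - A * p ^ k) = (1 - A) * qFac (p * A) p k := by
  rw [← qFac_succ, qFac_succ']

/-- Combines the off-diagonal factors (r,s) and (s,r), with x = y_s/y_r, a = k_r, b = k_s. It
produces one Vandermonde factor; p^(ab) contributes to p^(e₂(k)) and p^b to p^(∑ r k_r). -/
theorem qFac_mul_qFac_inv {p x : ℂ} (hp : p ≠ 0) (hx : x ≠ 0) (a b : ℕ) :
    qFac (x / p ^ b) p a * qFac (x⁻¹ / p ^ a) p b * ((1 - x * p ^ a / p ^ b) * p ^ (a * b + b)) =
      (1 - x) * (qFac (p * x) p a * qFac (p * x⁻¹) p b) := by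
  have hpb : p ^ b ≠ 0 := pow_ne_zero _ hp
  induction a with
  | zero =>
    have h := qFac_mul_one_sub x⁻¹ p b
    have e1 : (1 - x * p ^ 0 / p ^ b) * p ^ (0 * b + b) = -x * (1 - x⁻¹ * p ^ b) := by
      simp only [zero_mul, zero_add, pow_zero]
      field_simp
      ring
    have e2 : 1 - x = -x * (1 - x⁻¹) := by field_simp; ring
    rw [e1, e2, qFac_zero, qFac_zero, pow_zero, div_one]
    linear_combination (-x) * h
  | succ a ih =>
    have hpa : p ^ (a + 1) ≠ 0 := pow_ne_zero _ hp
    have h := qFac_mul_one_sub (x⁻¹ / p ^ (a + 1)) p b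
    have e0 : p * (x⁻¹ / p ^ (a + 1)) = x⁻¹ / p ^ a := by field_simp; ring
    rw [e0] at h
    have e1 : (1 - x * p ^ (a + 1) / p ^ b) * p ^ ((a + 1) * b + b) =
        -x * p ^ (a + 1) * p ^ (a * b + b) * (1 - x⁻¹ / p ^ (a + 1) * p ^ b) := by
      have : p ^ ((a + 1) * b + b) = p ^ (a * b + b) * p ^ b := by rw [← pow_add]; ring
      rw [this]
      field_simp
      ring
    have e2 : x / p ^ b * p ^ a = x * p ^ a / p ^ b := by ring
    have e3 : -x * p ^ (a + 1) * (1 - x⁻¹ / p ^ (a + 1)) = 1 - p * x * p ^ a := by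
      field_simp
      ring
    rw [qFac_succ, qFac_succ, e1, e2]
    linear_combination
      (qFac (x / p ^ b) p a * (1 - x * p ^ a / p ^ b) * (-x * p ^ (a + 1) * p ^ (a * b + b))) * h +
      (-x * p ^ (a + 1) * (1 - x⁻¹ / p ^ (a + 1))) * ih +
      ((1 - x) * (qFac (p * x) p a * qFac (p * x⁻¹) p b)) * e3

theorem qFac_inv_pow {p : ℂ} (hp : p ≠ 0) (k : ℕ) :
    qFac (1 / p ^ k) p k * ∏ i ∈ range k, (-p ^ (i + 1)) = qFac p p k := by
  induction k with
  | zero => simp [qFac]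
  | succ k ih =>
    have e : p * (1 / p ^ (k + 1)) = 1 / p ^ k := by field_simp; ring
    have e2 : (1 - 1 / p ^ (k + 1)) * (-p ^ (k + 1)) = 1 - p * p ^ k := by field_simp; ring
    rw [qFac_succ', e, prod_range_succ, qFac_succ, ← ih, ← e2]
    ring

theorem qFac_mul_eq_prod (A P : ℂ) (n k : ℕ) :
    qFac A P (n * k) = ∏ s ∈ range n, qFac (A * P ^ s) (P ^ n) k := by
  simp only [qFac]
  rw [prod_comm]
  induction k with
  | zero => simp
  | succ k ih =>
    rw [Nat.mul_succ, prod_range_add, ih, prod_range_succ]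
    congr 1
    exact prod_congr rfl fun s _ => by rw [pow_add, pow_mul]; ring

variable {n : ℕ}

theorem prod_prod_eq_diag_mul (f : Fin n → Fin n → ℂ) :
    ∏ r, ∏ s, f r s = (∏ r, f r r) * ∏ r, ∏ s ∈ Ioi r, f r s * f s r := by
  rw [prod_congr rfl fun r _ => (mul_prod_erase univ (f r) (mem_univ r)).symm, prod_mul_distrib]
  congr 1
  have h := Finset.prod_prod_Ioi_mul_eq_prod_prod_off_diag (fun i j => f j i)
  rw [h]
  refine prod_congr rfl fun r _ => prod_congr ?_ fun _ _ => rfl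
  ext s; simp

theorem prod_Ioi_pow (p : ℂ) (k : Fin n → ℕ) :
    ∏ r, ∏ s ∈ Ioi r, p ^ k s = p ^ ∑ r : Fin n, (r : ℕ) * k r := by
  have h : ∏ r, ∏ s ∈ Ioi r, p ^ k s = ∏ s : Fin n, ∏ r ∈ Iio s, p ^ k s :=
    prod_comm' (by simp)
  rw [h, ← prod_pow_eq_pow_sum]
  refine prod_congr rfl fun s _ => ?_
  rw [prod_const, Fin.card_Iio, ← pow_mul, mul_comm]

theorem prod_Ioi_pow_mul (p : ℂ) (k : Fin n → ℕ) :
    ∏ r, ∏ s ∈ Ioi r, p ^ (k r * k s) = p ^ e2 k := by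
  rw [e2, ← prod_pow_eq_pow_sum]
  exact prod_congr rfl fun r _ => prod_pow_eq_pow_sum _ _ _

theorem QGeneric.one_sub_ne_zero {p : ℂ} (hp : p ≠ 0) {y : Fin n → ℂ} (hy : QGeneric p y)
    {r s : Fin n} (h : r ≠ s) (a b : ℕ) : 1 - y s / y r * p ^ a / p ^ b ≠ 0 := fun e => by
  refine hy.2 r s h ((a : ℤ) - b) ?_
  rw [zpow_sub₀ hp, zpow_natCast, zpow_natCast]
  have h1 := hy.1 r
  have h2 : p ^ b ≠ 0 := pow_ne_zero _ hp
  have := sub_eq_zero.mp e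
  field_simp at this ⊢
  exact this

/-- The type `A` Vandermonde factor `∏_{r < s} (1 - x_r p ^ (k_r) / (x_s p ^ (k_s))) / (1 - x_r / x_s)`
for `x_r = 1 / y_r`. -/
noncomputable def vandermondeRatio (p : ℂ) (y : Fin n → ℂ) (k : Fin n → ℕ) : ℂ :=
  ∏ r, ∏ s ∈ Ioi r, (1 - y s / y r * p ^ k r / p ^ k s) / (1 - y s / y r)

theorem prod_qFac_div_pow {p : ℂ} (hp : p ≠ 0) {y : Fin n → ℂ} (hy : QGeneric p y)
    (k : Fin n → ℕ) :
    (∏ r, ∏ s, qFac (y s / y r / p ^ k s) p (k r)) *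
        ((∏ r, ∏ i ∈ range (k r), (-p ^ (i + 1))) * vandermondeRatio p y k *
          p ^ (∑ r : Fin n, (r : ℕ) * k r) * p ^ e2 k) =
      ∏ r, ∏ s, qFac (p * (y s / y r)) p (k r) := by
  rw [prod_prod_eq_diag_mul, prod_prod_eq_diag_mul, ← prod_Ioi_pow, ← prod_Ioi_pow_mul,
    vandermondeRatio]
  have h1 : ∀ A D E V S T : ℂ, A * D * (E * V * S * T) = (A * E) * (D * (V * S * T)) := by
    intros; ring
  rw [h1]
  congr 1
  · rw [← prod_mul_distrib]
    refine prod_congr rfl fun r _ => ?_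
    rw [div_self (hy.1 r), mul_one, qFac_inv_pow hp]
  · simp only [← prod_mul_distrib]
    refine prod_congr rfl fun r _ => prod_congr rfl fun s hs => ?_
    have hrs : r ≠ s := (mem_Ioi.mp hs).ne
    have hx : y s / y r ≠ 0 := div_ne_zero (hy.1 s) (hy.1 r)
    have h := qFac_mul_qFac_inv hp hx (k r) (k s)
    rw [inv_div] at h
    have h2 : 1 - y s / y r ≠ 0 := by simpa using hy.one_sub_ne_zero hp hrs 0 0
    generalize y s / y r = x at h h2 ⊢
    generalize qFac (x / p ^ k s) p (k r) = Q₁ at h ⊢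
    generalize qFac (y r / y s / p ^ k r) p (k s) = Q₂ at h ⊢
    rw [pow_add] at h
    apply mul_left_cancel₀ h2
    rw [← h]
    field_simp

theorem boxWeight_eq {p : ℂ} (hp : p ≠ 0) (hp1 : ∀ i : ℕ, p ^ (i + 1) ≠ 1) {y : Fin n → ℂ}
    (hy : QGeneric p y) (B : ℂ) (k : Fin n → ℕ) :
    boxWeight p y (fun s => B * y s) k =
      vandermondeRatio p y k *
        (∏ r, ∏ s, qFac (B * (y s / y r)) p (k r) / qFac (p * (y s / y r)) p (k r)) *
        (∏ r, y r ^ k r) * p ^ (∑ r : Fin n, (r : ℕ) * k r) * p ^ e2 k := by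
  have h1 : boxWeight p y (fun s => B * y s) k =
      (∏ r, y r ^ k r) / (∏ r, ∏ i ∈ range (k r), (-p ^ (i + 1))) *
        ∏ r, ∏ s, qFac (B * (y s / y r)) p (k r) / qFac (y s / y r / p ^ k s) p (k r) := by
    rw [boxWeight, ← prod_div_distrib, ← prod_mul_distrib]
    refine prod_congr rfl fun r _ => ?_
    rw [prod_mul_distrib]
    congr 1
    · have : y r ^ k r = ∏ _i ∈ range (k r), y r := by simp
      rw [this, ← prod_div_distrib]
      refine prod_congr rfl fun i _ => ?_
      field_simp
      ring
    · rw [prod_comm]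
      refine prod_congr rfl fun s _ => ?_
      rw [qFac, qFac, ← prod_div_distrib]
      refine prod_congr rfl fun i _ => ?_
      have h0 := hy.1 r
      have hpi : p ^ i ≠ 0 := pow_ne_zero _ hp
      have e1 : y r / p ^ i - B * y s = y r / p ^ i * (1 - B * (y s / y r) * p ^ i) := by
        field_simp
      have e2 : y r / p ^ i - y s / p ^ k s =
          y r / p ^ i * (1 - y s / y r / p ^ k s * p ^ i) := by
        field_simp
      rw [e1, e2, mul_div_mul_left _ _ (div_ne_zero h0 hpi)]
  have h2 := prod_qFac_div_pow hp hy k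
  have h3 : ∏ r, ∏ i ∈ range (k r), (-p ^ (i + 1)) ≠ 0 := prod_ne_zero_iff.mpr fun r _ =>
    prod_ne_zero_iff.mpr fun i _ => neg_ne_zero.mpr (pow_ne_zero _ hp)
  have h4 : ∏ r, ∏ s, qFac (p * (y s / y r)) p (k r) ≠ 0 := by
    refine prod_ne_zero_iff.mpr fun r _ => prod_ne_zero_iff.mpr fun s _ => ?_
    by_cases hrs : r = s
    · subst hrs
      rw [div_self (hy.1 r), mul_one]
      exact qFac_self_ne_zero hp1 _
    · refine prod_ne_zero_iff.mpr fun i _ => ?_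
      have := hy.one_sub_ne_zero hp hrs (i + 1) 0
      rw [pow_zero, div_one, pow_succ'] at this
      intro e
      exact this (by rw [← e]; ring)
  rw [h1]
  simp only [prod_div_distrib]
  rw [← h2] at h4 ⊢
  have h5 := left_ne_zero_of_mul h4
  generalize ∏ r, ∏ s, qFac (y s / y r / p ^ k s) p (k r) = Q at *
  generalize ∏ r, ∏ i ∈ range (k r), (-p ^ (i + 1)) = R at *
  have h6 := left_ne_zero_of_mul (right_ne_zero_of_mul h4)
  have h7 := right_ne_zero_of_mul (left_ne_zero_of_mul h6)
  have h8 := right_ne_zero_of_mul h6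
  have h9 := right_ne_zero_of_mul (right_ne_zero_of_mul h4)
  generalize vandermondeRatio p y k = V at *
  generalize p ^ (∑ r : Fin n, (r : ℕ) * k r) = S at *
  generalize p ^ e2 k = T at *
  field_simp

end Rearrangement

/-! ### Specialization to a geometric progression -/

section Specialization

open PowerSeries

/-- As P is not a root of unity, P^(-r) = P^(-s) P^(ni) forces s - r = ni; but |s - r| < n, so i = 0
and r = s. -/
theorem qGeneric_geometric {P : ℂ} (hP : P ≠ 0) (hP1 : ∀ i : ℕ, P ^ (i + 1) ≠ 1) (n : ℕ) :
    QGeneric (P ^ n) (fun r : Fin n => (P ^ (r : ℕ))⁻¹) := by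
  refine ⟨fun r => inv_ne_zero (pow_ne_zero _ hP), fun r s hrs i e => ?_⟩
  have hz : ∀ j : ℤ, P ^ j = 1 → j = 0 := by
    intro j hj
    rcases Int.eq_nat_or_neg j with ⟨l, rfl | rfl⟩
    · rcases l with _ | l
      · rfl
      · exact absurd (by exact_mod_cast hj) (hP1 l)
    · rcases l with _ | l
      · rfl
      · rw [zpow_neg, inv_eq_one] at hj
        exact absurd (by exact_mod_cast hj) (hP1 l)
  have h1 : P ^ ((s : ℤ) - r - n * i) = 1 := by
    rw [zpow_sub₀ hP, zpow_sub₀ hP, zpow_mul, zpow_natCast, zpow_natCast, zpow_natCast]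
    have h2 : P ^ (r : ℕ) ≠ 0 := pow_ne_zero _ hP
    have h3 : P ^ (s : ℕ) ≠ 0 := pow_ne_zero _ hP
    have h4 : (P ^ n) ^ i ≠ 0 := zpow_ne_zero _ (pow_ne_zero _ hP)
    field_simp at e ⊢
    exact e
  have h2 := hz _ h1
  have hr := r.2
  have hs := s.2
  have h3 : (s : ℤ) - r = n * i := by omega
  have h4 : i = 0 := by
    by_contra hi
    rcases lt_or_gt_of_ne hi with h | h <;> nlinarith
  subst h4
  exact hrs (Fin.ext (by omega))

/-- The points P^(-r) are w, Pw, …, P^(n-1) w with w = P^(-(n-1)), so the products in base P^n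
interleave to (Bwu;P)_∞/(wu;P)_∞. Formally, both series solve the same equation in base P^n, and its
solution is unique. -/
theorem coeff_qBinSeriesProd_geometric {P : ℂ} (hP : P ≠ 0) (hP1 : ∀ i : ℕ, P ^ (i + 1) ≠ 1)
    {n : ℕ} (hn : 1 ≤ n) (B : ℂ) (K : ℕ) :
    (P ^ (n - 1)) ^ K * coeff K (qBinSeriesProd (P ^ n) (fun r : Fin n => (P ^ (r : ℕ))⁻¹)
      (fun r : Fin n => B * (P ^ (r : ℕ))⁻¹)) = qFac B P K / qFac P P K := by
  obtain ⟨n, rfl⟩ := Nat.exists_eq_add_of_le' hn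
  rw [Nat.add_sub_cancel]
  have hPn : P ^ n ≠ 0 := pow_ne_zero _ hP
  set w : ℂ := (P ^ n)⁻¹ with hw
  have hp1 : ∀ i : ℕ, (P ^ (n + 1)) ^ (i + 1) ≠ 1 := fun i => by
    rw [← pow_mul]; exact hP1 ((n + 1) * (i + 1) - 1)
  -- Iterating the base-P equation; the case l = n + 1 is an equation in base P^(n+1), since `n` has
  -- been lowered by one.
  have hiter : ∀ l : ℕ, (∏ i ∈ range l, (1 - C (P ^ i * w) * X)) * qBinSeries P w (B * w) =
      (∏ i ∈ range l, (1 - C (P ^ i * (B * w)) * X)) *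
        rescale (P ^ l) (qBinSeries P w (B * w)) := by
    intro l
    induction l with
    | zero => simp
    | succ l ih =>
      have h := congrArg (rescale (P ^ l)) (qBinSeries_mul hP1 w (B * w))
      rw [map_mul, map_mul, rescale_one_sub_C_mul_X, rescale_one_sub_C_mul_X,
        rescale_rescale, ← pow_succ'] at h
      rw [prod_range_succ, prod_range_succ, mul_right_comm, ih, mul_right_comm, mul_assoc,
        h, mul_assoc]
  have hrefl : ∀ (A : ℂ), ∏ i ∈ range (n + 1), (1 - C (P ^ i * (A * w)) * X) =
      ∏ r : Fin (n + 1), (1 - C (A * (P ^ (r : ℕ))⁻¹) * X : PowerSeries ℂ) := fun A => by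
    rw [← Fin.prod_univ_eq_prod_range (fun i => (1 - C (P ^ i * (A * w)) * X : PowerSeries ℂ)),
      ← Equiv.prod_comp Fin.revPerm]
    refine prod_congr rfl fun r _ => ?_
    have : P ^ ((Fin.revPerm r : Fin (n + 1)) : ℕ) * (A * w) = A * (P ^ (r : ℕ))⁻¹ := by
      rw [hw, Fin.revPerm_apply, Fin.val_rev, Nat.add_sub_add_right]
      have h1 := r.2
      have h2 : P ^ n = P ^ (n - r) * P ^ (r : ℕ) := by rw [← pow_add]; congr 1; omega
      have h3 : P ^ (n - (r : ℕ)) ≠ 0 := pow_ne_zero _ hP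
      have h4 : P ^ (r : ℕ) ≠ 0 := pow_ne_zero _ hP
      rw [h2]
      field_simp
    rw [this]
  have heq : qBinSeriesProd (P ^ (n + 1)) (fun r : Fin (n + 1) => (P ^ (r : ℕ))⁻¹)
      (fun r : Fin (n + 1) => B * (P ^ (r : ℕ))⁻¹) = qBinSeries P w (B * w) := by
    refine eq_of_mul_eq_mul_rescale hp1 (D := ∏ r : Fin (n + 1), (1 - C ((P ^ (r : ℕ))⁻¹) * X))
      (N := ∏ r : Fin (n + 1), (1 - C (B * (P ^ (r : ℕ))⁻¹) * X)) ?_ ?_ ?_ ?_ ?_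
    · simp [map_prod]
    · simp [map_prod]
    · exact qBinSeriesProd_mul hp1 _ _
    · have h := hiter (n + 1)
      have h1 := hrefl 1
      simp only [one_mul] at h1
      rw [h1, hrefl] at h
      exact h
    · simp [qBinSeriesProd, map_prod, constantCoeff_qBinSeries]
  rw [heq, qBinSeries, coeff_mk, ← mul_div_assoc]
  congr 1
  have : (P ^ n) ^ K = ∏ _i ∈ range K, P ^ n := by simp
  rw [this, ← prod_mul_distrib, qFac]
  refine prod_congr rfl fun i _ => ?_
  rw [hw]
  field_simp

/-- The multiple `q`-binomial theorem in base `P ^ n` for `x_r = P ^ r`, which sums to a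
one-dimensional `q`-binomial coefficient in base `P`. -/
theorem sum_piAntidiag_eq_qFac_div {P : ℂ} (hP : P ≠ 0) (hP1 : ∀ i : ℕ, P ^ (i + 1) ≠ 1)
    {n : ℕ} (hn : 1 ≤ n) (B : ℂ) (K : ℕ) :
    ∑ k ∈ piAntidiag univ K,
      vandermondeRatio (P ^ n) (fun r : Fin n => (P ^ (r : ℕ))⁻¹) k *
      (∏ r : Fin n, qFac (B * P ^ ((r : ℕ) + 1) / P ^ n) P (n * k r) /
        qFac (P ^ ((r : ℕ) + 1)) P (n * k r)) * (P ^ (n - 1)) ^ (∑ r, k r) *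
      P ^ ((n - 1) * ∑ r : Fin n, (r : ℕ) * k r) * P ^ (n * e2 k) = qFac B P K / qFac P P K := by
  rw [← coeff_qBinSeriesProd_geometric hP hP1 hn]
  have hp1 : ∀ i : ℕ, (P ^ n) ^ (i + 1) ≠ 1 := fun i => by
    have h := hP1 (n * (i + 1) - 1)
    have : n * (i + 1) - 1 + 1 = n * (i + 1) := Nat.sub_add_cancel (Nat.mul_pos hn i.succ_pos)
    rwa [this, pow_mul] at h
  have hp : P ^ n ≠ 0 := pow_ne_zero _ hP
  have hy := qGeneric_geometric hP hP1 n
  rw [← sum_boxWeight hp hp1 _ K hy, mul_sum]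
  refine sum_congr rfl fun k hk => ?_
  rw [boxWeight_eq hp hp1 hy, (mem_piAntidiag.mp hk).1]
  -- After reversing s, the n factorials in base P^n start at consecutive powers of P and merge into
  -- one of length n k_r.
  have h1 : ∀ r : Fin n,
      ∏ s : Fin n, qFac (B * ((P ^ (s : ℕ))⁻¹ / (P ^ (r : ℕ))⁻¹)) (P ^ n) (k r) =
        qFac (B * P ^ ((r : ℕ) + 1) / P ^ n) P (n * k r) := fun r => by
    rw [qFac_mul_eq_prod, ← Fin.prod_univ_eq_prod_range
      (fun s => qFac (B * P ^ ((r : ℕ) + 1) / P ^ n * P ^ s) (P ^ n) (k r)),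
      ← Equiv.prod_comp Fin.revPerm]
    refine prod_congr rfl fun s _ => ?_
    congr 1
    rw [Fin.revPerm_apply, Fin.val_rev]
    have h1 := s.2
    have h2 : P ^ n = P ^ (n - (s + 1)) * (P ^ (s : ℕ) * P) := by
      rw [← pow_succ, ← pow_add]; congr 1; omega
    have h3 : P ^ (n - ((s : ℕ) + 1)) ≠ 0 := pow_ne_zero _ hP
    rw [h2]
    field_simp
    ring
  have h2 : ∀ r : Fin n,
      ∏ s : Fin n, qFac (P ^ n * ((P ^ (s : ℕ))⁻¹ / (P ^ (r : ℕ))⁻¹)) (P ^ n) (k r) =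
        qFac (P ^ ((r : ℕ) + 1)) P (n * k r) := fun r => by
    rw [qFac_mul_eq_prod, ← Fin.prod_univ_eq_prod_range
      (fun s => qFac (P ^ ((r : ℕ) + 1) * P ^ s) (P ^ n) (k r)),
      ← Equiv.prod_comp Fin.revPerm]
    refine prod_congr rfl fun s _ => ?_
    congr 1
    rw [Fin.revPerm_apply, Fin.val_rev]
    have h1 := s.2
    have h2 : P ^ n = P ^ (n - (s + 1)) * (P ^ (s : ℕ) * P) := by
      rw [← pow_succ, ← pow_add]; congr 1; omega
    rw [h2]
    field_simp
    ring
  simp only [prod_div_distrib, h1, h2]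
  have h3 : (∏ r : Fin n, (P ^ (r : ℕ))⁻¹ ^ k r) * (P ^ n) ^ (∑ r : Fin n, (r : ℕ) * k r) =
      P ^ ((n - 1) * ∑ r : Fin n, (r : ℕ) * k r) := by
    have h4 : ∏ r : Fin n, (P ^ (r : ℕ))⁻¹ ^ k r = (P ^ (∑ r : Fin n, (r : ℕ) * k r))⁻¹ := by
      rw [← prod_pow_eq_pow_sum, ← prod_inv_distrib]
      exact prod_congr rfl fun r _ => by rw [pow_mul, inv_pow]
    rw [h4, ← pow_mul]
    have h5 : n * ∑ r : Fin n, (r : ℕ) * k r = (n - 1) * (∑ r : Fin n, (r : ℕ) * k r) +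
        ∑ r : Fin n, (r : ℕ) * k r := by
      rw [Nat.sub_mul, one_mul, Nat.sub_add_cancel (Nat.le_mul_of_pos_left _ hn)]
    rw [h5, pow_add]
    have := pow_ne_zero (∑ r : Fin n, (r : ℕ) * k r) hP
    field_simp
  rw [← h3, pow_mul P n (e2 k)]
  ring

end Specialization

/-! ### Infinite products and the `q`-binomial theorem -/

section Analysis

open Filter Topology

variable {p : ℂ}

theorem pow_succ_ne_one_of_norm_lt_one (hp : ‖p‖ < 1) (i : ℕ) : p ^ (i + 1) ≠ 1 := fun h => by
  have h1 : ‖p ^ (i + 1)‖ < 1 := by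
    rw [norm_pow]; exact pow_lt_one₀ (norm_nonneg _) hp i.succ_ne_zero
  rw [h, norm_one] at h1
  exact lt_irrefl _ h1

theorem summable_norm_neg_mul_pow (hp : ‖p‖ < 1) (A : ℂ) :
    Summable fun i : ℕ => ‖-(A * p ^ i)‖ := by
  simpa [norm_mul, norm_pow] using (summable_geometric_of_lt_one (norm_nonneg p) hp).mul_left ‖A‖

theorem tendsto_qFac (hp : ‖p‖ < 1) (A : ℂ) :
    Tendsto (qFac A p) atTop (𝓝 (qFacInf A p)) := by
  have h := (multipliable_one_add_of_summable
    (summable_norm_neg_mul_pow hp A)).hasProd.tendsto_prod_nat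
  simp only [← sub_eq_add_neg] at h
  exact h

theorem qFacInf_ne_zero (hp : ‖p‖ < 1) {A : ℂ} (h : ∀ i : ℕ, 1 - A * p ^ i ≠ 0) :
    qFacInf A p ≠ 0 := by
  have := tprod_one_add_ne_zero_of_summable (f := fun i : ℕ => -(A * p ^ i))
    (fun i => by rw [← sub_eq_add_neg]; exact h i) (summable_norm_neg_mul_pow hp A)
  simp only [← sub_eq_add_neg] at this
  exact this

theorem one_sub_mul_pow_ne_zero (hp : ‖p‖ < 1) {A : ℂ} (hA : ‖A‖ < 1) (i : ℕ) :
    1 - A * p ^ i ≠ 0 := fun h => by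
  have h1 : ‖A * p ^ i‖ < 1 := by
    rw [norm_mul, norm_pow]
    exact mul_lt_one_of_nonneg_of_lt_one_left (norm_nonneg _) hA
      (pow_le_one₀ (norm_nonneg _) hp.le)
  rw [← sub_eq_zero.mp h, norm_one] at h1
  exact lt_irrefl _ h1

theorem qFacInf_ne_zero_of_norm_lt_one (hp : ‖p‖ < 1) {A : ℂ} (hA : ‖A‖ < 1) :
    qFacInf A p ≠ 0 :=
  qFacInf_ne_zero hp (one_sub_mul_pow_ne_zero hp hA)

theorem exists_norm_qFac_div_le (hp : ‖p‖ < 1) (A : ℂ) {B : ℂ} (hB : ‖B‖ < 1) :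
    ∃ C : ℝ, ∀ k, ‖qFac A p k / qFac B p k‖ ≤ C := by
  have h := ((tendsto_qFac hp A).div (tendsto_qFac hp B)
    (qFacInf_ne_zero_of_norm_lt_one hp hB)).norm
  obtain ⟨C, hC⟩ := h.bddAbove_range
  exact ⟨C, fun k => hC ⟨k, rfl⟩⟩

theorem summable_qBinomial (hp : ‖p‖ < 1) (A : ℂ) {z : ℂ} (hz : ‖z‖ < 1) :
    Summable fun k => qFac A p k / qFac p p k * z ^ k := by
  obtain ⟨C, hC⟩ := exists_norm_qFac_div_le hp A hp
  refine Summable.of_norm_bounded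
    ((summable_geometric_of_lt_one (norm_nonneg z) hz).mul_left C) fun k => ?_
  rw [norm_mul, norm_pow]
  exact mul_le_mul_of_nonneg_right (hC k) (pow_nonneg (norm_nonneg _) _)

/-- In f(z) - f(pz) the factor 1 - p^(k+1) cancels the last factor of (p;p)_(k+1), leaving 1 - A p^k
and a shift of index. -/
theorem tsum_qBinomial_rec (hp : ‖p‖ < 1) (A : ℂ) {z : ℂ} (hz : ‖z‖ < 1) :
    (1 - z) * ∑' k, qFac A p k / qFac p p k * z ^ k =
      (1 - A * z) * ∑' k, qFac A p k / qFac p p k * (p * z) ^ k := by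
  have hz' : ‖p * z‖ < 1 := by
    rw [norm_mul]; exact mul_lt_one_of_nonneg_of_lt_one_left (norm_nonneg _) hp hz.le
  have h1 := summable_qBinomial hp A hz
  have h2 := summable_qBinomial hp A hz'
  have h3 : ∑' k, (qFac A p k / qFac p p k * z ^ k - qFac A p k / qFac p p k * (p * z) ^ k) =
      z * ∑' k, (qFac A p k / qFac p p k * z ^ k -
        A * (qFac A p k / qFac p p k * (p * z) ^ k)) := by
    rw [(h1.sub h2).tsum_eq_zero_add, ← tsum_mul_left]
    simp only [pow_zero, sub_self, zero_add]
    refine tsum_congr fun k => ?_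
    rw [qFac_succ, qFac_succ]
    have h4 := qFac_self_ne_zero (pow_succ_ne_one_of_norm_lt_one hp) k
    have h5 : 1 - p ^ (k + 1) ≠ 0 :=
      sub_ne_zero.mpr (pow_succ_ne_one_of_norm_lt_one hp k).symm
    rw [← pow_succ' p k]
    field_simp
    ring
  rw [h1.tsum_sub h2, h1.tsum_sub (h2.mul_left A), tsum_mul_left] at h3
  linear_combination h3

/-- The `q`-binomial theorem. -/
theorem tsum_qBinomial (hp : ‖p‖ < 1) (A : ℂ) {z : ℂ} (hz : ‖z‖ < 1) :
    ∑' k, qFac A p k / qFac p p k * z ^ k = qFacInf (A * z) p / qFacInf z p := by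
  have hzN : ∀ N : ℕ, ‖p ^ N * z‖ < 1 := fun N => by
    rw [norm_mul, norm_pow]
    exact mul_lt_one_of_nonneg_of_lt_one_right (pow_le_one₀ (norm_nonneg _) hp.le)
      (norm_nonneg _) hz
  have hiter : ∀ N : ℕ, qFac z p N * ∑' k, qFac A p k / qFac p p k * z ^ k =
      qFac (A * z) p N * ∑' k, qFac A p k / qFac p p k * (p ^ N * z) ^ k := by
    intro N
    induction N with
    | zero => simp [qFac_zero]
    | succ N ih =>
      have h := tsum_qBinomial_rec hp A (hzN N)
      rw [← mul_assoc p, ← pow_succ'] at h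
      rw [qFac_succ, qFac_succ]
      linear_combination (1 - z * p ^ N) * ih + qFac (A * z) p N * h
  obtain ⟨C, hC⟩ := exists_norm_qFac_div_le hp A hp
  -- As N → ∞ the argument p^N z tends to 0 and only the constant term survives; the original series
  -- dominates, up to a constant.
  have hlim : Tendsto (fun N : ℕ => ∑' k, qFac A p k / qFac p p k * (p ^ N * z) ^ k) atTop
      (𝓝 (∑' k, if k = 0 then (1 : ℂ) else 0)) := by
    refine tendsto_tsum_of_dominated_convergence
      ((summable_geometric_of_lt_one (norm_nonneg z) hz).mul_left C) (fun k => ?_)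
      (Eventually.of_forall fun N k => ?_)
    · rcases k with _ | k
      · simp [qFac_zero]
      · have h1 : Tendsto (fun N : ℕ => p ^ N * z) atTop (𝓝 0) := by
          simpa using (tendsto_pow_atTop_nhds_zero_of_norm_lt_one hp).mul_const z
        simpa using (h1.pow (k + 1)).const_mul (qFac A p (k + 1) / qFac p p (k + 1))
    · rw [norm_mul, norm_pow]
      refine mul_le_mul (hC k) (pow_le_pow_left₀ (norm_nonneg _) ?_ _)
        (pow_nonneg (norm_nonneg _) _) ((norm_nonneg _).trans (hC k))
      rw [norm_mul, norm_pow]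
      exact mul_le_of_le_one_left (norm_nonneg _) (pow_le_one₀ (norm_nonneg _) hp.le)
  rw [tsum_ite_eq] at hlim
  have h1 := (tendsto_qFac hp (A * z)).mul hlim
  simp only [← hiter, mul_one] at h1
  have h2 := (tendsto_qFac hp z).mul_const (∑' k, qFac A p k / qFac p p k * z ^ k)
  rw [eq_div_iff (qFacInf_ne_zero_of_norm_lt_one hp hz), mul_comm]
  exact tendsto_nhds_unique h2 h1

/-! ### Multiple series -/

theorem hasSum_pi_prod {n : ℕ} (g : Fin n → ℕ → ℂ) (hg : ∀ r, Summable (g r)) :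
    HasSum (fun k : Fin n → ℕ => ∏ r, g r (k r)) (∏ r, ∑' i, g r i) := by
  induction n with
  | zero =>
    simp only [univ_eq_empty, prod_empty]
    simp
  | succ n ih =>
    have h := ih (fun r => g r.succ) fun r => hg _
    have hs : Summable fun x : ℕ × (Fin n → ℕ) => g 0 x.1 * ∏ r : Fin n, g r.succ (x.2 r) :=
      summable_mul_of_summable_norm (f := g 0)
        (g := fun k : Fin n → ℕ => ∏ r : Fin n, g r.succ (k r)) (hg 0).norm h.summable.norm
    have hm : HasSum (fun x : ℕ × (Fin n → ℕ) => g 0 x.1 * ∏ r : Fin n, g r.succ (x.2 r))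
        ((∑' i, g 0 i) * ∏ r : Fin n, ∑' i, g r.succ i) :=
      HasSum.mul (f := g 0) (g := fun k : Fin n → ℕ => ∏ r : Fin n, g r.succ (k r))
        (hg 0).hasSum h hs
    rw [← (Fin.consEquiv fun _ : Fin (n + 1) => ℕ).hasSum_iff]
    have e : (fun k : Fin (n + 1) → ℕ => ∏ r, g r (k r)) ∘
        (Fin.consEquiv fun _ : Fin (n + 1) => ℕ) =
        fun x : ℕ × (Fin n → ℕ) => g 0 x.1 * ∏ r : Fin n, g r.succ (x.2 r) := by
      funext x
      simp [Fin.consEquiv, Fin.prod_univ_succ]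
    rw [e, Fin.prod_univ_succ]
    exact hm

/-- In the Leibniz expansion each index j_r occurs in exactly one factor, that of row r. -/
theorem hasSum_det {n : ℕ} (M : Fin n → Fin n → ℕ → ℂ) (hM : ∀ r s, Summable (M r s)) :
    HasSum (fun j : Fin n → ℕ => (Matrix.of fun r s => M r s (j r)).det)
      (Matrix.of fun r s => ∑' i, M r s i).det := by
  simp only [← Matrix.det_transpose (Matrix.of _), Matrix.det_apply', Matrix.transpose_apply,
    Matrix.of_apply]
  exact hasSum_sum fun σ _ => (hasSum_pi_prod (fun r => M r (σ r)) fun r => hM _ _).mul_left _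

theorem vandermondeRatio_mul_pow {n : ℕ} {p : ℂ} (hp : p ≠ 0) {y : Fin n → ℂ}
    (hy0 : ∀ r, y r ≠ 0) (j : Fin n → ℕ) :
    vandermondeRatio p y j * p ^ (∑ r : Fin n, (r : ℕ) * j r) =
      (Matrix.vandermonde fun r => p ^ j r / y r).det /
        (Matrix.vandermonde fun r => 1 / y r).det := by
  rw [Matrix.det_vandermonde, Matrix.det_vandermonde, vandermondeRatio, ← prod_Ioi_pow,
    ← prod_mul_distrib, ← prod_div_distrib]
  refine prod_congr rfl fun r _ => ?_
  rw [← prod_mul_distrib, ← prod_div_distrib]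
  refine prod_congr rfl fun s _ => ?_
  have h1 := hy0 r
  have h2 := hy0 s
  have h3 : p ^ j s ≠ 0 := pow_ne_zero _ hp
  have e1 : (1 - y s / y r * p ^ j r / p ^ j s) * p ^ j s = y s * (p ^ j s / y s - p ^ j r / y r) := by
    field_simp
  have e2 : 1 - y s / y r = y s * (1 / y s - 1 / y r) := by field_simp
  rw [div_mul_eq_mul_div, e1, e2, mul_div_mul_left _ _ h2]

/-- Summing row r over j_r turns the entry (p^(j_r)/y_r)^s into y_r^(-s) times a quotient depending
on s alone. These quotients leave the determinant as column factors and the Vandermonde determinant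
in 1/y_r cancels, so the value does not depend on y. -/
theorem hasSum_vandermondeRatio {n : ℕ} {p : ℂ} (hp0 : p ≠ 0) (hp : ‖p‖ < 1) {y : Fin n → ℂ}
    (hy0 : ∀ r, y r ≠ 0) (hy : Function.Injective y) (A : ℂ) {z : ℂ} (hz : ‖z‖ < 1) :
    HasSum (fun j : Fin n → ℕ => vandermondeRatio p y j *
        (∏ r, qFac A p (j r) / qFac p p (j r)) * z ^ (∑ r, j r) *
        p ^ (∑ r : Fin n, (r : ℕ) * j r))
      (∏ r : Fin n, qFacInf (A * (z * p ^ (r : ℕ))) p / qFacInf (z * p ^ (r : ℕ)) p) := by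
  have hzs : ∀ s : Fin n, ‖z * p ^ (s : ℕ)‖ < 1 := fun s => by
    rw [norm_mul, norm_pow]
    exact mul_lt_one_of_nonneg_of_lt_one_left (norm_nonneg _) hz
      (pow_le_one₀ (norm_nonneg _) hp.le)
  set D := (Matrix.vandermonde fun r => 1 / y r).det with hD
  have hD0 : D ≠ 0 := by
    rw [hD, Matrix.det_vandermonde_ne_zero_iff]
    intro r s h
    simp only [one_div, inv_inj] at h
    exact hy h
  set M : Fin n → Fin n → ℕ → ℂ := fun r s i =>
    (1 / y r) ^ (s : ℕ) * (qFac A p i / qFac p p i * (z * p ^ (s : ℕ)) ^ i) with hM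
  have h := (hasSum_det M fun r s => (summable_qBinomial hp A (hzs s)).mul_left _).div_const D
  have h2 : (Matrix.of fun r s => ∑' i, M r s i).det / D =
      ∏ r : Fin n, qFacInf (A * (z * p ^ (r : ℕ))) p / qFacInf (z * p ^ (r : ℕ)) p := by
    have e : (Matrix.of fun r s => ∑' i, M r s i) = Matrix.of fun r s : Fin n =>
        (qFacInf (A * (z * p ^ (s : ℕ))) p / qFacInf (z * p ^ (s : ℕ)) p) *
          (Matrix.vandermonde fun r => 1 / y r) r s := by
      ext r s
      simp only [Matrix.of_apply, hM, tsum_mul_left, tsum_qBinomial hp A (hzs s),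
        Matrix.vandermonde_apply]
      ring
    rw [e, Matrix.det_mul_row, ← hD, mul_div_cancel_right₀ _ hD0]
  rw [← h2]
  refine h.congr_fun ?_
  intro j
  have e : (Matrix.of fun r s => M r s (j r)) = Matrix.of fun r s : Fin n =>
      (qFac A p (j r) / qFac p p (j r) * z ^ j r) *
        (Matrix.vandermonde fun r => p ^ j r / y r) r s := by
    ext r s
    simp only [Matrix.of_apply, hM, Matrix.vandermonde_apply]
    rw [mul_pow, div_pow, div_pow, ← pow_mul, ← pow_mul, mul_comm (s : ℕ)]
    ring
  rw [e, Matrix.det_mul_column, prod_mul_distrib, prod_pow_eq_pow_sum, mul_div_assoc,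
    ← vandermondeRatio_mul_pow hp0 hy0]
  ring

/-- The power of p supplies p^(k_s) to each pair r < s, which clears the negative power: the
numerator becomes p^(k_s) - (y_s/y_r) p^(k_r). -/
theorem exists_norm_vandermondeRatio_le {n : ℕ} {p : ℂ} (hp0 : p ≠ 0) (hp : ‖p‖ < 1)
    (y : Fin n → ℂ) :
    ∃ C : ℝ, ∀ k : Fin n → ℕ,
      ‖vandermondeRatio p y k * p ^ (∑ r : Fin n, (r : ℕ) * k r)‖ ≤ C := by
  refine ⟨∏ r, ∏ s ∈ Ioi r, (1 + ‖y s / y r‖) / ‖1 - y s / y r‖, fun k => ?_⟩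
  rw [vandermondeRatio, ← prod_Ioi_pow, ← prod_mul_distrib, norm_prod]
  refine prod_le_prod (fun _ _ => norm_nonneg _) fun r _ => ?_
  rw [← prod_mul_distrib, norm_prod]
  refine prod_le_prod (fun _ _ => norm_nonneg _) fun s _ => ?_
  have h3 : p ^ k s ≠ 0 := pow_ne_zero _ hp0
  have hle : ∀ i : ℕ, ‖p ^ i‖ ≤ 1 := fun i => by
    rw [norm_pow]; exact pow_le_one₀ (norm_nonneg _) hp.le
  have e1 : (1 - y s / y r * p ^ k r / p ^ k s) * p ^ k s = p ^ k s - y s / y r * p ^ k r := by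
    field_simp
  rw [div_mul_eq_mul_div, e1, norm_div]
  refine div_le_div_of_nonneg_right ((norm_sub_le _ _).trans (add_le_add (hle _) ?_))
    (norm_nonneg _)
  rw [norm_mul]
  exact mul_le_of_le_one_right (norm_nonneg _) (hle _)

theorem summable_pow_sum {n : ℕ} {w : ℝ} (hw0 : 0 ≤ w) (hw : w < 1) :
    Summable fun k : Fin n → ℕ => w ^ ∑ r, k r := by
  have h := (hasSum_pi_prod (fun (_ : Fin n) i => (w : ℂ) ^ i) fun _ =>
    summable_geometric_of_norm_lt_one (by simpa [abs_of_nonneg hw0] using hw)).summable.norm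
  refine h.congr fun k => ?_
  rw [prod_pow_eq_pow_sum, norm_pow, Complex.norm_real, Real.norm_of_nonneg hw0]

theorem tsum_pi_eq_tsum_sum_piAntidiag {n : ℕ} {g : (Fin n → ℕ) → ℂ} (hg : Summable g) :
    ∑' k, g k = ∑' K, ∑ k ∈ piAntidiag univ K, g k := by
  have h := (Finset.Nat.sigmaAntidiagonalTupleEquivTuple n).summable_iff.mpr hg
  rw [← (Finset.Nat.sigmaAntidiagonalTupleEquivTuple n).tsum_eq]
  refine (h.tsum_sigma).trans (tsum_congr fun K => ?_)
  rw [piAntidiag_univ_fin_eq_antidiagonalTuple]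
  exact Finset.tsum_subtype (Finset.Nat.antidiagonalTuple n K) g

theorem exists_norm_prod_le {n : ℕ} (g : Fin n → ℕ → ℂ) (hg : ∀ r, ∃ C : ℝ, ∀ i, ‖g r i‖ ≤ C) :
    ∃ C : ℝ, ∀ k : Fin n → ℕ, ‖∏ r, g r (k r)‖ ≤ C := by
  choose C hC using hg
  refine ⟨∏ r, C r, fun k => ?_⟩
  rw [norm_prod]
  exact prod_le_prod (fun _ _ => norm_nonneg _) fun r _ => hC r _

theorem summable_geometric_vandermondeRatio {P : ℂ} (hP0 : P ≠ 0) (hP : ‖P‖ < 1) {n : ℕ}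
    (hn : 1 ≤ n) (B : ℂ) {w : ℂ} (hw : ‖w‖ < 1) :
    Summable fun k : Fin n → ℕ =>
      (vandermondeRatio (P ^ n) (fun r : Fin n => (P ^ (r : ℕ))⁻¹) k *
      (∏ r : Fin n, qFac (B * P ^ ((r : ℕ) + 1) / P ^ n) P (n * k r) /
        qFac (P ^ ((r : ℕ) + 1)) P (n * k r)) * (P ^ (n - 1)) ^ (∑ r, k r) *
      P ^ ((n - 1) * ∑ r : Fin n, (r : ℕ) * k r) * P ^ (n * e2 k)) * w ^ ∑ r, k r := by
  have hle : ∀ i : ℕ, ‖P ^ i‖ ≤ 1 := fun i => by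
    rw [norm_pow]; exact pow_le_one₀ (norm_nonneg _) hP.le
  have hPn : ‖P ^ n‖ < 1 := by
    rw [norm_pow]; exact pow_lt_one₀ (norm_nonneg _) hP (by omega)
  obtain ⟨C₁, hC₁⟩ := exists_norm_vandermondeRatio_le (pow_ne_zero n hP0) hPn
    (fun r : Fin n => (P ^ (r : ℕ))⁻¹)
  obtain ⟨C₂, hC₂⟩ := exists_norm_prod_le
    (fun (r : Fin n) i => qFac (B * P ^ ((r : ℕ) + 1) / P ^ n) P (n * i) /
        qFac (P ^ ((r : ℕ) + 1)) P (n * i)) fun r => by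
      obtain ⟨C, hC⟩ := exists_norm_qFac_div_le hP (B * P ^ ((r : ℕ) + 1) / P ^ n)
        (B := P ^ ((r : ℕ) + 1)) (by
          rw [norm_pow]; exact pow_lt_one₀ (norm_nonneg _) hP (by omega))
      exact ⟨C, fun i => hC _⟩
  refine Summable.of_norm_bounded
    ((summable_pow_sum (n := n) (norm_nonneg w) hw).mul_left (C₁ * C₂)) fun k => ?_
  rw [norm_mul, norm_pow]
  refine mul_le_mul_of_nonneg_right ?_ (pow_nonneg (norm_nonneg _) _)
  -- Since r ≤ n - 1, the available powers of P contain the power of P^n that bounds the Vandermonde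
  -- factor; the surplus has norm at most 1.
  have hexp : ∃ l, (n - 1) * (∑ r, k r) + (n - 1) * ∑ r : Fin n, (r : ℕ) * k r =
      n * (∑ r : Fin n, (r : ℕ) * k r) + l := by
    refine Nat.exists_eq_add_of_le ?_
    rw [← mul_add, ← sum_add_distrib, mul_sum, mul_sum]
    refine sum_le_sum fun r _ => ?_
    have hr := r.2
    obtain ⟨n', rfl⟩ := Nat.exists_eq_add_of_le' hn
    rw [Nat.add_sub_cancel]
    nlinarith [Nat.mul_le_mul_right (k r) (Nat.le_of_lt_succ hr)]
  obtain ⟨l, hl⟩ := hexp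
  have e : (P ^ (n - 1)) ^ (∑ r, k r) * P ^ ((n - 1) * ∑ r : Fin n, (r : ℕ) * k r) =
      (P ^ n) ^ (∑ r : Fin n, (r : ℕ) * k r) * P ^ l := by
    rw [← pow_mul, ← pow_mul, ← pow_add, ← pow_add, hl]
  have e2 : ∀ V Q S T U : ℂ, V * Q * S * T * U = V * Q * (S * T) * U := by intros; ring
  have e3 : ∀ V Q S T U : ℂ, V * Q * (S * T) * U = (V * S) * Q * (T * U) := by intros; ring
  rw [e2, e, e3, norm_mul, norm_mul]
  have h1 := hC₁ k
  have h2 := hC₂ k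
  have h3 : ‖P ^ l * P ^ (n * _root_.e2 k)‖ ≤ 1 := by rw [← pow_add]; exact hle _
  have h4 := mul_le_mul h1 h2 (norm_nonneg _) ((norm_nonneg _).trans h1)
  exact (mul_le_of_le_one_right (mul_nonneg (norm_nonneg _) (norm_nonneg _)) h3).trans h4

theorem tsum_geometric_vandermondeRatio {P : ℂ} (hP0 : P ≠ 0) (hP : ‖P‖ < 1) {n : ℕ}
    (hn : 1 ≤ n) (B : ℂ) {w : ℂ} (hw : ‖w‖ < 1) :
    ∑' k : Fin n → ℕ,
      (vandermondeRatio (P ^ n) (fun r : Fin n => (P ^ (r : ℕ))⁻¹) k *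
      (∏ r : Fin n, qFac (B * P ^ ((r : ℕ) + 1) / P ^ n) P (n * k r) /
        qFac (P ^ ((r : ℕ) + 1)) P (n * k r)) * (P ^ (n - 1)) ^ (∑ r, k r) *
      P ^ ((n - 1) * ∑ r : Fin n, (r : ℕ) * k r) * P ^ (n * e2 k)) * w ^ ∑ r, k r =
      qFacInf (B * w) P / qFacInf w P := by
  rw [tsum_pi_eq_tsum_sum_piAntidiag (summable_geometric_vandermondeRatio hP0 hP hn B hw),
    ← tsum_qBinomial hP B hw]
  refine tsum_congr fun K => ?_
  rw [← sum_piAntidiag_eq_qFac_div hP0 (pow_succ_ne_one_of_norm_lt_one hP) hn B K, sum_mul]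
  exact sum_congr rfl fun k hk => by rw [(mem_piAntidiag.mp hk).1]

theorem summable_mul_mul_of_norm_le_one {ι κ : Type*} {f : ι → ℂ} {g : κ → ℂ}
    (hf : Summable f) (hg : Summable g) {X : ι → κ → ℂ} (hX : ∀ i k, ‖X i k‖ ≤ 1) :
    Summable fun x : ι × κ => f x.1 * g x.2 * X x.1 x.2 := by
  refine Summable.of_norm_bounded (summable_mul_of_summable_norm hf.norm hg.norm).norm
    fun x => ?_
  rw [norm_mul]
  exact mul_le_of_le_one_right (norm_nonneg _) (hX _ _)

end Analysis

/-! ### The transformation -/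

section Transformation

theorem qPow_add (L x y : ℂ) : qPow L (x + y) = qPow L x * qPow L y := by
  rw [qPow, add_mul, Complex.exp_add]; rfl

theorem qPow_mul_natCast (L x : ℂ) (k : ℕ) : qPow L (x * k) = qPow L x ^ k := by
  rw [qPow, qPow, ← Complex.exp_nat_mul]; congr 1; ring

theorem qPow_sub (L x y : ℂ) : qPow L (x - y) = qPow L x / qPow L y := by
  rw [qPow, sub_mul, Complex.exp_sub]; rfl

theorem qPow_ne_zero (L x : ℂ) : qPow L x ≠ 0 := Complex.exp_ne_zero _

theorem vandermondeA_eq (L u : ℂ) {n : ℕ} (k : Fin n → ℕ) :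
    vandermondeA L u k =
      vandermondeRatio (qPow L u ^ n) (fun r : Fin n => (qPow L u ^ (r : ℕ))⁻¹) k := by
  refine prod_congr rfl fun r _ => prod_congr rfl fun s _ => ?_
  have e : u * ((r : ℂ) - (s : ℂ)) + u * n * ((k r : ℂ) - (k s : ℂ)) =
      u * ((r : ℕ) : ℂ) - u * ((s : ℕ) : ℂ) + (u * n * (k r : ℂ) - u * n * (k s : ℂ)) := by ring
  rw [e, mul_sub, qPow_add, qPow_sub, qPow_sub]
  simp only [qPow_mul_natCast]
  congr 2
  · rw [inv_div_inv]; ring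
  · rw [inv_div_inv]

/-- The summand of the `m`-fold series, without the factors which depend on the base `q ^ h`. -/
noncomputable def coeffJ (q L t a b : ℂ) {m : ℕ} (j : Fin m → ℕ) : ℂ :=
  vandermondeA L t j *
    (∏ r : Fin m, qFac (-b * q / a) (qPow L (t * m)) (j r) /
      qFac (qPow L (t * m)) (qPow L (t * m)) (j r)) *
    (a * qPow L (t * m)) ^ (∑ r, j r) *
    qPow L (t * m) ^ (∑ r : Fin m, (r : ℕ) * j r)

/-- The summand of the `n`-fold series, without the factors which depend on the base
`q ^ (t m)`. -/
noncomputable def coeffK (q L h c d : ℂ) {n : ℕ} (k : Fin n → ℕ) : ℂ :=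
  (vandermondeRatio (qPow L h ^ n) (fun r : Fin n => (qPow L h ^ (r : ℕ))⁻¹) k *
    (∏ r : Fin n, qFac (c * q / d * qPow L h ^ ((r : ℕ) + 1) / qPow L h ^ n) (qPow L h) (n * k r) /
      qFac (qPow L h ^ ((r : ℕ) + 1)) (qPow L h) (n * k r)) *
    (qPow L h ^ (n - 1)) ^ (∑ r, k r) *
    qPow L h ^ ((n - 1) * ∑ r : Fin n, (r : ℕ) * k r) * qPow L h ^ (n * e2 k)) *
    (d * qPow L h) ^ ∑ r, k r

variable {q L h t a b c d : ℂ} {m n : ℕ}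

theorem hasSum_coeffJ (hm : 1 ≤ m) (ha : a ≠ 0) (hL : qPow L 1 = q) (hqt : ‖qPow L t‖ < 1)
    {Y : ℂ} (hY : ‖a * qPow L (t * m) * Y‖ < 1) :
    HasSum (fun j : Fin m → ℕ => coeffJ q L t a b j * Y ^ ∑ r, j r)
      (∏ r : Fin m, qFacInf (-b * qPow L (1 + t * m * ((r : ℂ) + 1)) * Y) (qPow L (t * m)) /
        qFacInf (a * qPow L (t * m * ((r : ℂ) + 1)) * Y) (qPow L (t * m))) := by
  have hT := qPow_ne_zero L t
  have hgen := qGeneric_geometric hT (pow_succ_ne_one_of_norm_lt_one hqt) m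
  have hp : ‖qPow L t ^ m‖ < 1 := by
    rw [norm_pow]; exact pow_lt_one₀ (norm_nonneg _) hqt (by omega)
  have h1 := hasSum_vandermondeRatio (pow_ne_zero m hT) hp hgen.1 hgen.injective (-b * q / a)
    (z := a * qPow L t ^ m * Y) (by rwa [qPow_mul_natCast] at hY)
  have e0 : ∀ r : Fin m, qPow L (t * m * ((r : ℂ) + 1)) =
      qPow L t ^ m * (qPow L t ^ m) ^ (r : ℕ) := fun r => by
    have : t * m * ((r : ℂ) + 1) = t * m * (((r : ℕ) + 1 : ℕ) : ℂ) := by push_cast; ring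
    rw [this, qPow_mul_natCast, qPow_mul_natCast, pow_succ']
  have e1 : (∏ r : Fin m, qFacInf (-b * qPow L (1 + t * m * ((r : ℂ) + 1)) * Y) (qPow L (t * m)) /
        qFacInf (a * qPow L (t * m * ((r : ℂ) + 1)) * Y) (qPow L (t * m))) =
      ∏ r : Fin m, qFacInf (-b * q / a * (a * qPow L t ^ m * Y * (qPow L t ^ m) ^ (r : ℕ)))
          (qPow L t ^ m) /
        qFacInf (a * qPow L t ^ m * Y * (qPow L t ^ m) ^ (r : ℕ)) (qPow L t ^ m) := by
    refine prod_congr rfl fun r _ => ?_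
    rw [qPow_add, hL, e0, qPow_mul_natCast]
    congr 2
    · field_simp
    · ring
  rw [e1]
  refine h1.congr_fun fun j => ?_
  rw [coeffJ, vandermondeA_eq, qPow_mul_natCast, mul_pow _ Y]
  ring

theorem summable_coeffK (hn : 1 ≤ n) (hqh : ‖qPow L h‖ < 1) (hdz : ‖d * qPow L h‖ < 1) :
    Summable (coeffK q L h c d : (Fin n → ℕ) → ℂ) :=
  summable_geometric_vandermondeRatio (qPow_ne_zero L h) hqh hn (c * q / d) hdz

theorem tsum_coeffK (hn : 1 ≤ n) (hd : d ≠ 0) (hL : qPow L 1 = q) (hqh : ‖qPow L h‖ < 1)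
    {Y : ℂ} (hY : ‖d * qPow L h * Y‖ < 1) :
    ∑' k : Fin n → ℕ, coeffK q L h c d k * Y ^ ∑ r, k r =
      qFacInf (c * qPow L (h + 1) * Y) (qPow L h) / qFacInf (d * qPow L h * Y) (qPow L h) := by
  have e : c * q / d * (d * qPow L h * Y) = c * qPow L (h + 1) * Y := by
    rw [qPow_add, hL]; field_simp
  rw [← e, ← tsum_geometric_vandermondeRatio (qPow_ne_zero L h) hqh hn (c * q / d) hY]
  refine tsum_congr fun k => ?_
  rw [coeffK, mul_pow _ Y]
  ring

theorem termJ_eq (hn : 1 ≤ n) (hd : d ≠ 0) (hL : qPow L 1 = q) (hqh : ‖qPow L h‖ < 1)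
    (hX : ‖qPow L (h * t * m * n)‖ ≤ 1) (hdz : ‖d * qPow L h‖ < 1) (j : Fin m → ℕ) :
    termJ q L h t a b c d n m j =
      qFacInf (d * qPow L h) (qPow L h) / qFacInf (c * qPow L (h + 1)) (qPow L h) *
        ∑' k : Fin n → ℕ, coeffJ q L t a b j * coeffK q L h c d k *
          (qPow L (h * t * m * n) ^ ∑ r, j r) ^ ∑ r, k r := by
  have hY : ‖d * qPow L h * qPow L (h * t * m * n) ^ ∑ r, j r‖ < 1 := by
    rw [norm_mul, norm_pow]
    exact mul_lt_one_of_nonneg_of_lt_one_left (norm_nonneg _) hdz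
      (pow_le_one₀ (norm_nonneg _) hX)
  simp only [mul_assoc (coeffJ q L t a b j)]
  rw [tsum_mul_left, tsum_coeffK hn hd hL hqh hY, termJ, coeffJ, qFacC, qFacC]
  have e : h * (t * m * n * ((∑ r, j r : ℕ) : ℂ)) = h * t * m * n * ((∑ r, j r : ℕ) : ℂ) := by
    ring
  rw [e, qPow_mul_natCast L (h * t * m * n), qPow_mul_natCast L (t * m) (∑ r : Fin m, _)]
  -- `inv_inv` also holds at 0, so the reciprocal of a factorial of complex order has the prescribed
  -- reading even when the infinite product in that factorial's denominator vanishes.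
  simp only [div_eq_mul_inv, mul_inv, inv_inv]
  ring

theorem termK_eq (hn : 1 ≤ n) (hm : 1 ≤ m) (ha : a ≠ 0) (hL : qPow L 1 = q)
    (hqt : ‖qPow L t‖ < 1) (hX : ‖qPow L (h * t * m * n)‖ ≤ 1) (haw : ‖a * qPow L (t * m)‖ < 1)
    (k : Fin n → ℕ) :
    termK L h t a b c d n m k =
      (∏ r : Fin m, qFacInf (a * qPow L (t * m * ((r : ℂ) + 1))) (qPow L (t * m)) /
        qFacInf (-b * qPow L (t * m * ((r : ℂ) + 1) + 1)) (qPow L (t * m))) *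
        ∑' j : Fin m → ℕ, coeffJ q L t a b j * coeffK q L h c d k *
          (qPow L (h * t * m * n) ^ ∑ r, j r) ^ ∑ r, k r := by
  have hY : ‖a * qPow L (t * m) * qPow L (h * t * m * n) ^ ∑ r, k r‖ < 1 := by
    rw [norm_mul, norm_pow]
    exact mul_lt_one_of_nonneg_of_lt_one_left (norm_nonneg _) haw
      (pow_le_one₀ (norm_nonneg _) hX)
  have h1 : ∑' j : Fin m → ℕ, coeffJ q L t a b j * coeffK q L h c d k *
        (qPow L (h * t * m * n) ^ ∑ r, j r) ^ ∑ r, k r =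
      coeffK q L h c d k * ∏ r : Fin m,
        qFacInf (-b * qPow L (1 + t * m * ((r : ℂ) + 1)) * qPow L (h * t * m * n) ^ ∑ r, k r)
          (qPow L (t * m)) /
        qFacInf (a * qPow L (t * m * ((r : ℂ) + 1)) * qPow L (h * t * m * n) ^ ∑ r, k r)
          (qPow L (t * m)) := by
    rw [← (hasSum_coeffJ (b := b) hm ha hL hqt hY).tsum_eq, ← tsum_mul_left]
    refine tsum_congr fun j => ?_
    rw [← pow_mul, ← pow_mul, mul_comm (∑ r, j r)]
    ring
  have h2 : coeffK q L h c d k = vandermondeA L h k *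
      (∏ r : Fin n, qFac (c * qPow L (1 + h * (((r : ℂ) + 1) - n)) / d) (qPow L h) (n * k r) /
        qFac (qPow L (h * ((r : ℂ) + 1))) (qPow L h) (n * k r)) *
      (d * qPow L (h * n)) ^ (∑ r, k r) *
      qPow L (h * ((n : ℂ) - 1) * ((∑ r : Fin n, (r : ℕ) * k r : ℕ) : ℂ)) *
      qPow L (h * n * (e2 k : ℂ)) := by
    have e1 : ∀ r : Fin n, qPow L (h * ((r : ℂ) + 1)) = qPow L h ^ ((r : ℕ) + 1) := fun r => by
      rw [← qPow_mul_natCast]; push_cast; rfl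
    have e2 : ∀ r : Fin n, c * qPow L (1 + h * (((r : ℂ) + 1) - n)) / d =
        c * q / d * qPow L h ^ ((r : ℕ) + 1) / qPow L h ^ n := fun r => by
      rw [qPow_add, hL, mul_sub, qPow_sub, e1, qPow_mul_natCast]
      ring
    have e3 : qPow L (h * ((n : ℂ) - 1)) = qPow L h ^ (n - 1) := by
      rw [← qPow_mul_natCast, Nat.cast_sub hn, Nat.cast_one]
    -- Splits the argument d q^(hn) into the power P^(n-1) belonging to the multiple q-binomial
    -- theorem and its free variable d q^h.
    have e4 : d * qPow L h ^ n = qPow L h ^ (n - 1) * (d * qPow L h) := by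
      conv_lhs => rw [← Nat.sub_add_cancel hn, pow_succ]
      ring
    simp only [e1, e2]
    rw [coeffK, vandermondeA_eq, qPow_mul_natCast L (h * ((n : ℂ) - 1)), e3,
      qPow_mul_natCast L (h * n), qPow_mul_natCast L h n, e4, mul_pow _ (d * qPow L h),
      pow_mul (qPow L h) (n - 1) (∑ r : Fin n, _), pow_mul (qPow L h) n (_root_.e2 k)]
    ring
  have e5 : t * m * (h * n * ((∑ i, k i : ℕ) : ℂ)) = h * t * m * n * ((∑ i, k i : ℕ) : ℂ) := by
    ring
  rw [h1, h2, termK]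
  simp only [qFacC, e5, qPow_mul_natCast L (h * t * m * n), add_comm _ (1 : ℂ),
    div_eq_mul_inv, mul_inv, inv_inv, prod_mul_distrib, prod_inv_distrib]
  ring

end Transformation

theorem mainTheorem8 (n m : ℕ) (hn : 1 ≤ n) (hm : 1 ≤ m)
    (q L h t a b c d : ℂ)
    -- `L` is the value of `log q` by which the powers `q ^ α` are defined
    (hL : Complex.exp L = q)
    -- the usual convergence conditions
    (hqh : ‖qPow L h‖ < 1) (hqt : ‖qPow L t‖ < 1) (hqht : ‖qPow L (h * t)‖ < 1)
    -- the convergence conditions on the parameters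
    (haw : ‖a * qPow L (t * m)‖ < 1) (hdz : ‖d * qPow L h‖ < 1)
    -- `a` and `d` occur as denominators
    (ha : a ≠ 0) (hd : d ≠ 0)
    -- no zero factor in the products in the denominators
    (hb : ∀ r : Fin m, ∀ i : ℕ,
      1 - (-b * qPow L (t * m * ((r : ℂ) + 1) + 1)) * qPow L (t * m) ^ i ≠ 0)
    (hc : ∀ i : ℕ, 1 - (c * qPow L (h + 1)) * qPow L h ^ i ≠ 0) :
    Summable (termJ q L h t a b c d n m) ∧
    Summable (termK L h t a b c d n m) ∧
    (∏ r : Fin m, qFacInf (a * qPow L (t * m * ((r : ℂ) + 1))) (qPow L (t * m)) /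
        qFacInf (-b * qPow L (t * m * ((r : ℂ) + 1) + 1)) (qPow L (t * m))) *
      (qFacInf (c * qPow L (h + 1)) (qPow L h) / qFacInf (d * qPow L h) (qPow L h)) *
      (∑' j : Fin m → ℕ, termJ q L h t a b c d n m j) =
    ∑' k : Fin n → ℕ, termK L h t a b c d n m k := by
  have hL1 : qPow L 1 = q := by rw [qPow, one_mul, hL]
  -- X = (q^(ht))^(mn); the condition on q^(ht) controls the coupling factor X^(|j||k|).
  have hX : ‖qPow L (h * t * m * n)‖ ≤ 1 := by
    rw [qPow_mul_natCast, qPow_mul_natCast, norm_pow, norm_pow]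
    exact pow_le_one₀ (by positivity) (pow_le_one₀ (norm_nonneg _) hqht.le)
  have hJ : Summable (coeffJ q L t a b : (Fin m → ℕ) → ℂ) := by
    simpa using (hasSum_coeffJ (b := b) (Y := 1) hm ha hL1 hqt (by simpa using haw)).summable
  have hK : Summable (coeffK q L h c d : (Fin n → ℕ) → ℂ) := summable_coeffK hn hqh hdz
  set F : (Fin m → ℕ) → (Fin n → ℕ) → ℂ := fun j k =>
    coeffJ q L t a b j * coeffK q L h c d k *
      (qPow L (h * t * m * n) ^ ∑ r, j r) ^ ∑ r, k r with hF
  have hS : Summable (Function.uncurry F) :=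
    summable_mul_mul_of_norm_le_one (X := fun (j : Fin m → ℕ) (k : Fin n → ℕ) =>
      (qPow L (h * t * m * n) ^ ∑ r, j r) ^ ∑ r, k r) hJ hK fun j k => by
        rw [norm_pow, norm_pow]
        exact pow_le_one₀ (by positivity) (pow_le_one₀ (norm_nonneg _) hX)
  have hG1 : qFacInf (d * qPow L h) (qPow L h) ≠ 0 := qFacInf_ne_zero_of_norm_lt_one hqh hdz
  have hG2 : qFacInf (c * qPow L (h + 1)) (qPow L h) ≠ 0 := qFacInf_ne_zero hqh hc
  have eJ : termJ q L h t a b c d n m = fun j => _ * ∑' k, F j k :=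
    funext fun j => termJ_eq hn hd hL1 hqh hX hdz j
  have eK : termK L h t a b c d n m = fun k => _ * ∑' j, F j k :=
    funext fun k => termK_eq hn hm ha hL1 hqt hX haw k
  refine ⟨?_, ?_, ?_⟩
  · rw [eJ]
    exact hS.prod.mul_left _
  · rw [eK]
    exact hS.prod_symm.prod.mul_left _
  -- After the exchange of sums, the a, b prefactor is common to both sides, and the c, d prefactor
  -- is the inverse of the constant in `termJ_eq`.
  · rw [eJ, eK, tsum_mul_left, tsum_mul_left, hS.tsum_comm, mul_assoc]
    congr 1
    rw [← mul_assoc, div_mul_div_cancel₀ hG1, div_self hG2, one_mul]
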